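/- Let $\Omega\subset\mathbb R^n$ be a bounded connected open set with Lipschitz boundary (near each boundary point, $\Omega$ is, in suitable orthonormal coordinates, the set strictly above the graph of a Lipschitz function), and let $\Sigma\subset\overline\Omega$ be compact. For $x,y\in\overline\Omega$ let $\delta_\Omega(x,y)$ be the geodesic distance, i.e. the infimum of $\mathcal H^1(S)$ over Lipschitz curves $S\subset\overline\Omega$ joining $x$ to $y$, and let $\delta_\Omega(x,\Sigma)=\inf_{z\in\Sigma}\delta_\Omega(x,z)$ (equal to $+\infty$ if $\Sigma=\emptyset$). Let $c$ be the geodesic cost with free transport on $\Sigma$, $$c(x,y)=\min\{\delta_\Omega(x,y),\ \delta_\Omega(x,\Sigma)+\delta_\Omega(y,\Sigma)\}.$$ Let $\mu,\nu$ be Borel probability measures on $\overline\Omega$ and $$T_c(\mu,\nu)=\inf\Big\{\int_{\overline\Omega\times\overline\Omega}c\,d\gamma\ :\ \gamma \text{ is a measure on } \overline\Omega\times\overline\Omega \text{ with marginals } \mu,\nu\Big\}.$$ Then $$T_c(\mu,\nu)=\min\Big\{|\lambda|(\overline\Omega)\ :\ \lambda\in\mathcal M_b(\overline\Omega;\mathbb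 R^n),\ -\operatorname{div}\lambda=\mu-\nu\ \text{on}\ \overline\Omega\setminus\Sigma\Big\},$$ and the minimum is attained. Here $\mathcal M_b(\overline\Omega;\mathbb R^n)$ is the set of bounded $\mathbb R^n$-valued Borel measures on $\overline\Omega$, $|\lambda|$ is the total variation measure of $\lambda$ with respect to the Euclidean norm, and the divergence condition means that $\int_{\overline\Omega}\nabla\varphi\cdot d\lambda=\int_{\overline\Omega}\varphi\,d\mu-\int_{\overline\Omega}\varphi\,d\nu$ for all $\varphi\in C^\infty(\mathbb R^n)$ with compact support contained in $\mathbb R^n\setminus\Sigma$. The same formula, with the minimum attained, holds for the cost $$c(x,y)=\inf\{\mathcal H^1(S\setminus\Sigma)\ :\ S\subset\overline\Omega \text{ a Lipschitz curve joining } x \text{ to } y\},$$ provided that this cost vanishes on $\Sigma\times\Sigma$ (for instance if any two points of $\Sigma$ are joined by a Lipschitz curve contained in $\Sigma$). -/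

import Mathlib

open MeasureTheory Set Topology
open scoped ENNReal NNReal ContDiff

namespace GeodesicTransport

/-- `Ω` has a Lipschitz boundary: near each boundary point `p` there is a direction `e` such that
`Ω` is locally the set of points lying strictly above the graph, in the direction `e`, of a
Lipschitz function of the coordinates orthogonal to `e` (a function on the whole space which is
invariant under translations along `e`). -/
def HasLipschitzBoundary {n : ℕ} (Ω : Set (EuclideanSpace ℝ (Fin n))) : Prop :=
  ∀ p ∈ frontier Ω, ∃ e : EuclideanSpace ℝ (Fin n), ‖e‖ = 1 ∧
    ∃ (K : ℝ≥0) (g : EuclideanSpace ℝ (Fin n) → ℝ), LipschitzWith K g ∧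
      (∀ (x : EuclideanSpace ℝ (Fin n)) (t : ℝ), g (x + t • e) = g x) ∧
      ∃ U ∈ 𝓝 p, ∀ x ∈ U, (x ∈ Ω ↔ g x < inner ℝ e x)

/-- `γ : [0,1] → ℝⁿ` is a Lipschitz curve joining `x` to `y` inside `A`. -/
def IsLipschitzCurve {n : ℕ} (A : Set (EuclideanSpace ℝ (Fin n)))
    (x y : EuclideanSpace ℝ (Fin n)) (γ : unitInterval → EuclideanSpace ℝ (Fin n)) : Prop :=
  (∃ K : ℝ≥0, LipschitzWith K γ) ∧ γ 0 = x ∧ γ 1 = y ∧ range γ ⊆ A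

/-- The infimum of `ℋ¹(S \ Z)` over the Lipschitz curves `S` joining `x` to `y` in the closure
of `Ω`. -/
noncomputable def curveCost {n : ℕ} (Ω Z : Set (EuclideanSpace ℝ (Fin n)))
    (x y : EuclideanSpace ℝ (Fin n)) : ℝ≥0∞ :=
  ⨅ (γ : unitInterval → EuclideanSpace ℝ (Fin n)) (_ : IsLipschitzCurve (closure Ω) x y γ),
    Measure.hausdorffMeasure 1 (range γ \ Z)

/-- The geodesic distance on the closure of `Ω`: the infimum of the lengths `ℋ¹(S)` of the
Lipschitz curves `S` joining `x` to `y` in the closure of `Ω`. -/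
noncomputable def geodesicDist {n : ℕ} (Ω : Set (EuclideanSpace ℝ (Fin n)))
    (x y : EuclideanSpace ℝ (Fin n)) : ℝ≥0∞ :=
  curveCost Ω ∅ x y

/-- The geodesic distance to the set `Z` (equal to `∞` if `Z` is empty). -/
noncomputable def geodesicInfDist {n : ℕ} (Ω Z : Set (EuclideanSpace ℝ (Fin n)))
    (x : EuclideanSpace ℝ (Fin n)) : ℝ≥0∞ :=
  ⨅ z ∈ Z, geodesicDist Ω x z

/-- The geodesic cost with free transport on `Z`: either go directly from `x` to `y`, or go from
`x` to `Z`, move for free on `Z`, and go from `Z` to `y`. -/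
noncomputable def freeZoneCost {n : ℕ} (Ω Z : Set (EuclideanSpace ℝ (Fin n)))
    (x y : EuclideanSpace ℝ (Fin n)) : ℝ≥0∞ :=
  min (geodesicDist Ω x y) (geodesicInfDist Ω Z x + geodesicInfDist Ω Z y)

/-- The Monge–Kantorovich cost `T_c(μ, ν)`: the infimum of `∫ c dγ` over the transport plans `γ`,
the measures on the product with marginals `μ` and `ν`. -/
noncomputable def transportCost {X : Type*} [MeasurableSpace X] (c : X → X → ℝ≥0∞)
    (μ ν : Measure X) : ℝ≥0∞ :=
  ⨅ (γ : Measure (X × X)) (_ : γ.map Prod.fst = μ ∧ γ.map Prod.snd = ν),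
    ∫⁻ p, c p.1 p.2 ∂γ

/-- `-div Λ = μ - ν` on `closure Ω \ Z`: for every smooth `φ` with compact support in `ℝⁿ \ Z`,
the integral of `∇φ` against the vector measure `Λ` on `closure Ω` equals `∫ φ d(μ - ν)`. -/
def NegDivEq {n : ℕ} {Ω : Set (EuclideanSpace ℝ (Fin n))} (Z : Set (EuclideanSpace ℝ (Fin n)))
    (Λ : VectorMeasure (closure Ω) (EuclideanSpace ℝ (Fin n))) (μ ν : Measure (closure Ω)) :
    Prop :=
  ∀ φ : EuclideanSpace ℝ (Fin n) → ℝ, ContDiff ℝ ∞ φ → HasCompactSupport φ →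
    tsupport φ ⊆ Zᶜ →
      Λ.integral (fun x : closure Ω => gradient φ (x : EuclideanSpace ℝ (Fin n))) (innerSL ℝ) =
        (∫ x : closure Ω, φ x ∂μ) - ∫ x : closure Ω, φ x ∂ν

/-- The total masses `|Λ|(closure Ω)` of the bounded `ℝⁿ`-valued measures `Λ` on `closure Ω` with
`-div Λ = μ - ν` on `closure Ω \ Z`. -/
def flowMasses {n : ℕ} {Ω : Set (EuclideanSpace ℝ (Fin n))} (Z : Set (EuclideanSpace ℝ (Fin n)))
    (μ ν : Measure (closure Ω)) : Set ℝ≥0∞ :=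
  {m | ∃ Λ : VectorMeasure (closure Ω) (EuclideanSpace ℝ (Fin n)),
    Λ.variation univ < ⊤ ∧ NegDivEq Z Λ μ ν ∧ Λ.variation univ = m}

end GeodesicTransport

/-! Both sides are values of linear programs with the same dual: maximize `∫ u d(μ - ν)` over
functions `u` that are 1-Lipschitz for the cost. On the transport side this is
Kantorovich–Rubinstein duality, since the free-zone cost is a continuous pseudo-distance. On the
flow side the competitors are smooth, supported off `Z`, with gradient of norm at most 1 on `closure
Ω`. The two classes have the same supremum.

Both strong dualities come from one Farkas lemma for measures, `exists_measure_integral_le` (M.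
Riesz extension followed by Riesz representation), which produces the measure itself and so also
gives attainment. A flow is sought as a measure on pairs (point, direction in the unit ball), whose
mass dominates the variation of the vector measure it induces.

A test function with gradient at most `s` is `s`-Lipschitz for the cost
(`abs_sub_le_mul_freeZoneCost`); by `exists_flow_of_dual_le` some flow then has mass at most the
transport cost. Conversely, a function 1-Lipschitz for the cost is constant on `Z` and, after
subtracting that constant, is uniformly approximated by test functions with gradient at most `1 + ε`
(`exists_testFunction_approx`); hence no flow is cheaper than the transport. The Lipschitz boundary
enters twice: it makes geodesic distance locally comparable to Euclidean distance, and it allows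
`closure Ω` to be pushed into `Ω` before mollifying.

The curve cost reduces to the free-zone cost: once it vanishes on `Z × Z`, the two agree
(`curveCost_eq_freeZoneCost`). -/

namespace GeodesicTransport

/-! ### Farkas lemma for measures on a compact space -/

section Duality

variable {X : Type*} [TopologicalSpace X] [CompactSpace X] [MeasurableSpace X] [BorelSpace X]

/-- A positive linear functional on the continuous functions on a compact Hausdorff space is the
integral against a finite measure. -/
theorem exists_measure_of_positive [T2Space X] (l : C(X, ℝ) →ₗ[ℝ] ℝ)
    (hl : ∀ f, 0 ≤ f → 0 ≤ l f) :
    ∃ m : Measure X, IsFiniteMeasure m ∧ ∀ f : C(X, ℝ), ∫ x, f x ∂m = l f := by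
  let L : CompactlySupportedContinuousMap X ℝ →ₗ[ℝ] ℝ :=
    { toFun := fun f => l f.toContinuousMap
      map_add' := fun f g => l.map_add f.toContinuousMap g.toContinuousMap
      map_smul' := fun a f => l.map_smul a f.toContinuousMap }
  let L' := PositiveLinearMap.mk₀ L (fun f hf => hl f.toContinuousMap hf)
  refine ⟨RealRMK.rieszMeasure L', inferInstance, fun f => ?_⟩
  exact RealRMK.integral_rieszMeasure L' (CompactlySupportedContinuousMap.continuousMapEquiv f)

/-- A Farkas lemma for measures: a convex cone of constraints `∫ g ≤ b` is satisfied by some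
finite measure as soon as every constraint with `g ≥ 0` has `b ≥ 0`. -/
theorem exists_measure_integral_le [T2Space X] (C : PointedCone ℝ (C(X, ℝ) × ℝ))
    (hC : ∀ p ∈ C, 0 ≤ p.1 → 0 ≤ p.2) (h1 : ∃ b : ℝ, ((1 : C(X, ℝ)), b) ∈ C) :
    ∃ m : Measure X, IsFiniteMeasure m ∧ ∀ p ∈ C, ∫ x, p.1 x ∂m ≤ p.2 := by
  -- The weakened constraints: smaller integrand, larger bound. A functional nonnegative on `s` and
  -- equal to the second coordinate on `{0} × ℝ` encodes the measure.
  let s : PointedCone ℝ (C(X, ℝ) × ℝ) :=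
    { carrier := {q | ∃ p ∈ C, q.1 ≤ p.1 ∧ p.2 ≤ q.2}
      zero_mem' := ⟨0, C.zero_mem, le_rfl, le_rfl⟩
      add_mem' := by
        rintro a b ⟨p, hp, h, h'⟩ ⟨q, hq, k, k'⟩
        exact ⟨p + q, C.add_mem hp hq, add_le_add h k, add_le_add h' k'⟩
      smul_mem' := by
        rintro r a ⟨p, hp, h, h'⟩
        refine ⟨r • p, Submodule.smul_mem C r hp, ?_, ?_⟩
        · intro x
          exact mul_le_mul_of_nonneg_left (h x) r.2
        · exact mul_le_mul_of_nonneg_left h' r.2 }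
  let f : (C(X, ℝ) × ℝ) →ₗ.[ℝ] ℝ :=
    { domain := (⊥ : Submodule ℝ C(X, ℝ)).prod ⊤
      toFun := (LinearMap.snd ℝ C(X, ℝ) ℝ).comp (Submodule.subtype _) }
  have hf : ∀ x : f.domain, (x : C(X, ℝ) × ℝ) ∈ s → 0 ≤ f x := by
    rintro ⟨⟨g, r⟩, hg⟩ ⟨p, hp, h, h'⟩
    have hg0 : g = 0 := hg.1
    subst hg0
    exact (hC p hp h).trans h'
  obtain ⟨b, hb⟩ := h1
  -- Cofinality for the extension theorem: the constraint with constant integrand 1, scaled by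
  -- `‖h‖`, dominates `h`.
  have hd : ∀ y, ∃ x : f.domain, (x : C(X, ℝ) × ℝ) + y ∈ s := by
    rintro ⟨h, r⟩
    refine ⟨⟨(0, ‖h‖ * b - r), by simp [f]⟩, ((⟨‖h‖, norm_nonneg _⟩ : ℝ≥0) • (1, b)),
      Submodule.smul_mem C _ hb, ?_, ?_⟩
    · intro x
      have := (le_abs_self _).trans (h.norm_coe_le_norm x)
      simpa [NNReal.smul_def] using this
    · simp
  obtain ⟨F, hF, hFs⟩ := riesz_extension s f hf hd
  have hF0 : ∀ r : ℝ, F (0, r) = r := fun r => hF ⟨(0, r), by simp [f]⟩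
  have hsplit : ∀ (g : C(X, ℝ)) (r : ℝ), F (g, r) = F (g, 0) + r := by
    intro g r
    rw [← hF0 r, ← map_add, hF0]
    simp
  -- The sign is reversed because `(-g, 0)` lies in `s` when `g ≥ 0`; then `0 ≤ F p` reads `∫ p.1 ≤
  -- p.2`.
  obtain ⟨m, hm, hmF⟩ := exists_measure_of_positive (-(F.comp (LinearMap.inl ℝ C(X, ℝ) ℝ)))
    (fun g hg => by
      have : 0 ≤ F (-g, 0) := hFs _ ⟨0, C.zero_mem, neg_nonpos.2 hg, le_rfl⟩
      have h2 : F (-g, 0) = -F (g, 0) := by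
        rw [← map_neg]
        simp
      simpa [h2] using this)
  refine ⟨m, hm, fun p hp => ?_⟩
  have h := hFs p ⟨p, hp, le_rfl, le_rfl⟩
  rw [hmF]
  have h2 := hsplit p.1 p.2
  simp only [LinearMap.neg_apply, LinearMap.comp_apply, LinearMap.inl_apply]
  change 0 ≤ F (p.1, p.2) at h
  linarith

end Duality

/-! ### Kantorovich and Kantorovich–Rubinstein duality -/

section Kantorovich

variable {X : Type*} [MetricSpace X] [CompactSpace X] [MeasurableSpace X] [BorelSpace X]

theorem integrable_of_continuous {Y : Type*} [TopologicalSpace Y] [CompactSpace Y]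
    [MeasurableSpace Y] [BorelSpace Y] (m : Measure Y) [IsFiniteMeasure m]
    {f : Y → ℝ} (hf : Continuous f) : Integrable f m :=
  BoundedContinuousFunction.integrable m (BoundedContinuousFunction.mkOfCompact ⟨f, hf⟩)

/-- Kantorovich duality on a compact space, for a continuous cost. -/
theorem exists_plan_of_dual_le (μ ν : Measure X) [IsProbabilityMeasure μ] [IsProbabilityMeasure ν]
    (c : C(X × X, ℝ)) (D : ℝ)
    (hD : ∀ φ ψ : C(X, ℝ), (∀ x y, φ x + ψ y ≤ c (x, y)) → ∫ x, φ x ∂μ + ∫ y, ψ y ∂ν ≤ D) :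
    ∃ γ : Measure (X × X), IsFiniteMeasure γ ∧ γ.map Prod.fst = μ ∧ γ.map Prod.snd = ν ∧
      ∫ p, c p ∂γ ≤ D := by
  have hi : ∀ (m : Measure X) [IsProbabilityMeasure m] (f : C(X, ℝ)), Integrable (fun x => f x) m :=
    fun m _ f => integrable_of_continuous m f.continuous
  -- Elements with `t = 0` impose the marginals; `φ = ψ = 0`, `t = 1` imposes the bound on the cost.
  let C : PointedCone ℝ (C(X × X, ℝ) × ℝ) :=
    { carrier := {p | ∃ (φ ψ : C(X, ℝ)) (t : ℝ), 0 ≤ t ∧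
        (∀ x y, p.1 (x, y) = φ x + ψ y + t * c (x, y)) ∧
        p.2 = ∫ x, φ x ∂μ + ∫ y, ψ y ∂ν + t * D}
      zero_mem' := ⟨0, 0, 0, le_rfl, by simp, by simp⟩
      add_mem' := by
        rintro a b ⟨φ, ψ, t, ht, h, h'⟩ ⟨φ', ψ', t', ht', k, k'⟩
        refine ⟨φ + φ', ψ + ψ', t + t', add_nonneg ht ht', fun x y => ?_, ?_⟩
        · simp only [Prod.fst_add, ContinuousMap.add_apply, h, k]
          ring
        · simp only [Prod.snd_add, ContinuousMap.add_apply, h', k']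
          rw [integral_add (hi μ φ) (hi μ φ'), integral_add (hi ν ψ) (hi ν ψ')]
          ring
      smul_mem' := by
        rintro r a ⟨φ, ψ, t, ht, h, h'⟩
        refine ⟨(r : ℝ) • φ, (r : ℝ) • ψ, r * t, mul_nonneg r.2 ht, fun x y => ?_, ?_⟩
        · change (r : ℝ) * a.1 (x, y) = (r : ℝ) * φ x + (r : ℝ) * ψ y + r * t * c (x, y)
          rw [h]
          ring
        · change (r : ℝ) * a.2 = ∫ x, (r : ℝ) * φ x ∂μ + ∫ x, (r : ℝ) * ψ x ∂ν + r * t * D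
          rw [integral_const_mul, integral_const_mul, h']
          ring }
  have hC : ∀ p ∈ C, 0 ≤ p.1 → 0 ≤ p.2 := by
    rintro p ⟨φ, ψ, t, ht, h, h'⟩ hp
    have hp' : ∀ x y, 0 ≤ φ x + ψ y + t * c (x, y) := fun x y => (hp (x, y)).trans_eq (h x y)
    -- For `t = 0`, integrate `φ + ψ ≥ 0` against `μ` and then `ν`. For `t > 0`, the pair `-φ/t`,
    -- `-ψ/t` is admissible in the dual problem.
    rcases ht.eq_or_lt with rfl | ht
    · have h1 : ∀ y, 0 ≤ ∫ x, φ x ∂μ + ψ y := by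
        intro y
        have h2 : 0 ≤ ∫ x, (φ x + ψ y) ∂μ := integral_nonneg fun x => by simpa using hp' x y
        rw [integral_add (hi μ φ) (integrable_const _)] at h2
        simpa using h2
      have h2 : 0 ≤ ∫ y, (∫ x, φ x ∂μ + ψ y) ∂ν := integral_nonneg h1
      rw [integral_add (integrable_const _) (hi ν ψ)] at h2
      simpa [h'] using h2
    · have := hD ((-t⁻¹) • φ) ((-t⁻¹) • ψ) (fun x y => by
        simp only [ContinuousMap.smul_apply, smul_eq_mul]
        have h1 := mul_nonneg (inv_nonneg.2 ht.le) (hp' x y)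
        have h2 : t⁻¹ * (t * c (x, y)) = c (x, y) := by field_simp
        nlinarith)
      simp only [ContinuousMap.smul_apply, smul_eq_mul, integral_const_mul] at this
      rw [h']
      have h3 := mul_le_mul_of_nonneg_left this ht.le
      have h4 : t * (-t⁻¹ * ∫ x, φ x ∂μ + -t⁻¹ * ∫ y, ψ y ∂ν)
          = -(∫ x, φ x ∂μ + ∫ y, ψ y ∂ν) := by
        field_simp
        ring
      linarith
  obtain ⟨γ, hγ, hγC⟩ := exists_measure_integral_le C hC ⟨1, 1, 0, 0, le_rfl, by simp, by simp⟩
  have key : ∀ φ ψ : C(X, ℝ),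
      ∫ p, (φ p.1 + ψ p.2) ∂γ = ∫ x, φ x ∂μ + ∫ y, ψ y ∂ν := by
    have hle : ∀ φ ψ : C(X, ℝ),
        ∫ p, (φ p.1 + ψ p.2) ∂γ ≤ ∫ x, φ x ∂μ + ∫ y, ψ y ∂ν := by
      intro φ ψ
      exact hγC (φ.comp ContinuousMap.fst + ψ.comp ContinuousMap.snd, _)
        ⟨φ, ψ, 0, le_rfl, fun x y => by simp, by simp; rfl⟩
    intro φ ψ
    refine le_antisymm (hle φ ψ) ?_
    have := hle (-φ) (-ψ)
    simp only [ContinuousMap.neg_apply, ← neg_add, integral_neg] at this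
    linarith
  refine ⟨γ, hγ, ?_, ?_, ?_⟩
  · refine ext_of_forall_integral_eq_of_IsFiniteMeasure fun f => ?_
    rw [integral_map measurable_fst.aemeasurable f.continuous.aestronglyMeasurable]
    simpa using key f.toContinuousMap 0
  · refine ext_of_forall_integral_eq_of_IsFiniteMeasure fun f => ?_
    rw [integral_map measurable_snd.aemeasurable f.continuous.aestronglyMeasurable]
    simpa using key 0 f.toContinuousMap
  · exact hγC (c, D) ⟨0, 0, 1, zero_le_one, by simp, by simp⟩

/-- Kantorovich–Rubinstein duality on a compact space, for a continuous pseudo-distance. -/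
theorem exists_plan_of_lipschitz_dual_le (μ ν : Measure X) [IsProbabilityMeasure μ]
    [IsProbabilityMeasure ν] (c : X → X → ℝ) (hc : Continuous (fun p : X × X => c p.1 p.2))
    (hself : ∀ x, c x x = 0) (htri : ∀ x y z, c x z ≤ c x y + c y z) (D : ℝ)
    (hD : ∀ u : C(X, ℝ), (∀ x y, u x - u y ≤ c x y) → ∫ x, u x ∂μ - ∫ x, u x ∂ν ≤ D) :
    ∃ γ : Measure (X × X), IsFiniteMeasure γ ∧ γ.map Prod.fst = μ ∧ γ.map Prod.snd = ν ∧
      ∫ p, c p.1 p.2 ∂γ ≤ D := by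
  refine exists_plan_of_dual_le μ ν ⟨fun p : X × X => c p.1 p.2, hc⟩ D fun φ ψ h => ?_
  have : Nonempty X := by
    by_contra hX
    have : IsEmpty X := not_nonempty_iff.1 hX
    exact IsProbabilityMeasure.ne_zero μ (Measure.eq_zero_of_isEmpty μ)
  -- The `c`-transform of `ψ`. The triangle inequality makes it 1-Lipschitz for `c`; admissibility
  -- gives `φ ≤ u`, and `c x x = 0` gives `ψ ≤ -u`, so the single potential `u` does at least as
  -- well as the pair.
  let u : X → ℝ := fun x => ⨅ y, (c x y - ψ y)
  have hbdd : ∀ x, BddBelow (range fun y => c x y - ψ y) := fun x =>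
    ⟨φ x, by
      rintro _ ⟨y, rfl⟩
      have := h x y
      simp only [ContinuousMap.coe_mk] at this
      linarith⟩
  have hu : ∀ x y, u x - u y ≤ c x y := by
    intro x y
    rw [sub_le_comm]
    refine le_ciInf fun z => ?_
    have h1 : u x ≤ c x z - ψ z := ciInf_le (hbdd x) z
    linarith [htri x y z]
  have hucont : Continuous u := by
    rw [continuous_iff_continuousAt]
    intro x
    have h1 : Filter.Tendsto (fun y => max (c x y) (c y x)) (𝓝 x) (𝓝 0) := by
      have : Continuous fun y => max (c x y) (c y x) :=
        (hc.comp (by fun_prop : Continuous fun y => (x, y))).max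
          (hc.comp (by fun_prop : Continuous fun y => (y, x)))
      simpa [hself] using this.tendsto x
    rw [ContinuousAt, tendsto_iff_dist_tendsto_zero]
    refine squeeze_zero (fun _ => dist_nonneg) (fun y => ?_) h1
    rw [Real.dist_eq, abs_le]
    constructor
    · linarith [hu x y, le_max_left (c x y) (c y x)]
    · linarith [hu y x, le_max_right (c x y) (c y x)]
  have h1 : ∫ x, φ x ∂μ ≤ ∫ x, u x ∂μ := by
    refine integral_mono (integrable_of_continuous μ φ.continuous)
      (integrable_of_continuous μ hucont) fun x => le_ciInf fun y => ?_
    have := h x y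
    simp only [ContinuousMap.coe_mk] at this
    linarith
  have h2 : ∫ x, ψ x ∂ν ≤ ∫ x, -u x ∂ν := by
    refine integral_mono (integrable_of_continuous ν ψ.continuous)
      (integrable_of_continuous ν hucont.neg) fun x => ?_
    have : u x ≤ c x x - ψ x := ciInf_le (hbdd x) x
    rw [hself] at this
    change ψ x ≤ -u x
    linarith
  rw [integral_neg] at h2
  have := hD ⟨u, hucont⟩ hu
  simp only [ContinuousMap.coe_mk] at this
  linarith

end Kantorovich

/-! ### Curve costs as pseudo-distances, and comparison of the two costs -/

section Curves

variable {n : ℕ} {Ω Z : Set (EuclideanSpace ℝ (Fin n))} {x y z : EuclideanSpace ℝ (Fin n)}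

theorem curveCost_le_of_lipschitzWith {f : ℝ → EuclideanSpace ℝ (Fin n)} {K : ℝ≥0}
    (hf : LipschitzWith K f) {a b : ℝ} (hab : a ≤ b) (hΩ : f '' Icc a b ⊆ closure Ω) :
    curveCost Ω Z (f a) (f b) ≤ Measure.hausdorffMeasure 1 (f '' Icc a b \ Z) := by
  let g : unitInterval → ℝ := fun t => a + t * (b - a)
  have hg : LipschitzWith ⟨b - a, sub_nonneg.2 hab⟩ g := by
    refine LipschitzWith.of_dist_le_mul fun s t => le_of_eq ?_
    rw [Real.dist_eq, Subtype.dist_eq, Real.dist_eq]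
    change |a + s * (b - a) - (a + t * (b - a))| = (b - a) * |(s : ℝ) - t|
    rw [show a + s * (b - a) - (a + t * (b - a)) = (b - a) * ((s : ℝ) - t) by ring, abs_mul,
      abs_of_nonneg (sub_nonneg.2 hab)]
  have hr : range (f ∘ g) ⊆ f '' Icc a b := by
    rintro _ ⟨t, rfl⟩
    refine ⟨g t, ⟨?_, ?_⟩, rfl⟩
    · have := mul_nonneg t.2.1 (sub_nonneg.2 hab)
      simp only [g]
      linarith
    · have := mul_le_mul_of_nonneg_right t.2.2 (sub_nonneg.2 hab)
      simp only [g]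
      linarith
  refine (iInf₂_le (f ∘ g) ⟨⟨_, hf.comp hg⟩, by simp [g], by simp [g], hr.trans hΩ⟩).trans ?_
  exact measure_mono (sdiff_subset_sdiff_left hr)

theorem IsLipschitzCurve.exists_extension {A : Set (EuclideanSpace ℝ (Fin n))}
    {γ : unitInterval → EuclideanSpace ℝ (Fin n)}
    (hγ : IsLipschitzCurve A x y γ) :
    ∃ (f : ℝ → EuclideanSpace ℝ (Fin n)) (K : ℝ≥0), LipschitzWith K f ∧
      (∀ t ≤ 0, f t = x) ∧ (∀ t, 1 ≤ t → f t = y) ∧ f '' Icc 0 1 = range γ := by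
  obtain ⟨⟨K, hK⟩, h0, h1, -⟩ := hγ
  refine ⟨IccExtend zero_le_one γ, _, hK.comp (LipschitzWith.projIcc zero_le_one),
    fun t ht => ?_, fun t ht => ?_, ?_⟩
  · rw [IccExtend_of_le_left _ _ ht, ← h0]
    rfl
  · rw [IccExtend_of_right_le _ _ ht, ← h1]
    rfl
  · ext p
    constructor
    · rintro ⟨t, ht, rfl⟩
      exact ⟨_, rfl⟩
    · rintro ⟨t, rfl⟩
      exact ⟨t, t.2, IccExtend_val _ _ t⟩

theorem curveCost_triangle : curveCost Ω Z x z ≤ curveCost Ω Z x y + curveCost Ω Z y z := by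
  conv_rhs => unfold curveCost
  simp only [ENNReal.iInf_add, ENNReal.add_iInf]
  refine le_iInf₂ fun γ₂ h₂ => le_iInf₂ fun γ₁ h₁ => ?_
  obtain ⟨f₁, K₁, hf₁, hl₁, hr₁, he₁⟩ := h₁.exists_extension
  obtain ⟨f₂, K₂, hf₂, hl₂, hr₂, he₂⟩ := h₂.exists_extension
  -- Concatenation as a sum: `f₁` is constantly `y` after time 1 and `f₂ (t - 1)` is constantly `y`
  -- before it, so Lipschitz continuity needs no gluing.
  let h : ℝ → EuclideanSpace ℝ (Fin n) := fun t => f₁ t + (f₂ (t - 1) - y)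
  have hleft : ∀ t ≤ 1, h t = f₁ t := fun t ht => by simp [h, hl₂ (t - 1) (by linarith)]
  have hright : ∀ t, 1 ≤ t → h t = f₂ (t - 1) := fun t ht => by simp [h, hr₁ t ht]
  have hlip : LipschitzWith (K₁ + K₂ * 1) h := by
    have : LipschitzWith (K₂ * 1) fun t : ℝ => f₂ (t - 1) - y := by
      refine LipschitzWith.of_dist_le_mul fun s t => ?_
      rw [dist_sub_right, mul_one]
      refine (hf₂.dist_le_mul _ _).trans (by rw [dist_sub_right])
    exact hf₁.add this
  have hsub : h '' Icc 0 2 ⊆ range γ₁ ∪ range γ₂ := by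
    rintro _ ⟨t, ht, rfl⟩
    rcases le_total t 1 with h1 | h1
    · rw [hleft t h1, ← he₁]
      exact Or.inl ⟨t, ⟨ht.1, h1⟩, rfl⟩
    · rw [hright t h1, ← he₂]
      exact Or.inr ⟨t - 1, ⟨by linarith, by linarith [ht.2]⟩, rfl⟩
  have h0 : h 0 = x := by rw [hleft 0 zero_le_one, hl₁ 0 le_rfl]
  have h2 : h 2 = z := by rw [hright 2 one_le_two, hr₂ _ (by norm_num)]
  have := curveCost_le_of_lipschitzWith (Ω := Ω) (Z := Z) hlip (zero_le_two)
    (hsub.trans (union_subset h₁.2.2.2 h₂.2.2.2))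
  rw [h0, h2] at this
  refine this.trans ((measure_mono (sdiff_subset_sdiff_left hsub)).trans ?_)
  rw [union_sdiff_distrib]
  exact measure_union_le _ _

theorem curveCost_comm_le : curveCost Ω Z x y ≤ curveCost Ω Z y x := by
  refine le_iInf₂ fun γ hγ => ?_
  have hlip : ∃ K : ℝ≥0, LipschitzWith K (γ ∘ unitInterval.symm) := by
    obtain ⟨K, hK⟩ := hγ.1
    refine ⟨K, LipschitzWith.of_dist_le_mul fun s t => (hK.dist_le_mul _ _).trans_eq ?_⟩
    congr 1
    rw [Subtype.dist_eq, Subtype.dist_eq, unitInterval.coe_symm_eq, unitInterval.coe_symm_eq,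
      dist_sub_left]
  have hsub : range (γ ∘ unitInterval.symm) ⊆ range γ := range_comp_subset_range _ _
  refine (iInf₂_le (γ ∘ unitInterval.symm)
    ⟨hlip, by simpa using hγ.2.2.1, by simpa using hγ.2.1, hsub.trans hγ.2.2.2⟩).trans ?_
  exact measure_mono (sdiff_subset_sdiff_left hsub)

theorem curveCost_comm : curveCost Ω Z x y = curveCost Ω Z y x :=
  le_antisymm curveCost_comm_le curveCost_comm_le

theorem curveCost_le_edist (h : segment ℝ x y ⊆ closure Ω) : curveCost Ω Z x y ≤ edist x y := by
  have hs : (AffineMap.lineMap x y : ℝ → EuclideanSpace ℝ (Fin n)) '' Icc 0 1 = segment ℝ x y :=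
    (segment_eq_image_lineMap ℝ x y).symm
  have := curveCost_le_of_lipschitzWith (Ω := Ω) (Z := Z) (f := AffineMap.lineMap x y)
    (lipschitzWith_lineMap x y) zero_le_one (by rwa [hs])
  rw [hs, AffineMap.lineMap_apply_zero, AffineMap.lineMap_apply_one] at this
  refine this.trans ((measure_mono sdiff_subset).trans ?_)
  rw [hausdorffMeasure_segment]

theorem curveCost_self (h : x ∈ closure Ω) : curveCost Ω Z x x = 0 := by
  simpa using curveCost_le_edist (Z := Z) (Ω := Ω) (x := x) (y := x) (by simpa)

theorem curveCost_le_geodesicDist : curveCost Ω Z x y ≤ geodesicDist Ω x y :=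
  iInf₂_mono fun _ _ => measure_mono (sdiff_subset_sdiff_right (empty_subset _))

theorem freeZoneCost_self (h : x ∈ closure Ω) : freeZoneCost Ω Z x x = 0 := by
  simp [freeZoneCost, geodesicDist, curveCost_self h]

theorem geodesicInfDist_le_add :
    geodesicInfDist Ω Z x ≤ geodesicDist Ω x y + geodesicInfDist Ω Z y := by
  simp only [geodesicInfDist, ENNReal.add_iInf]
  exact iInf₂_mono fun _ _ => curveCost_triangle

theorem freeZoneCost_comm : freeZoneCost Ω Z x y = freeZoneCost Ω Z y x := by
  rw [freeZoneCost, freeZoneCost, geodesicDist, geodesicDist, curveCost_comm, add_comm]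

/-- Four cases, by whether each leg is direct or passes through `Z`. If both pass through `Z`, the
middle point is skipped because motion on `Z` is free. -/
theorem freeZoneCost_triangle :
    freeZoneCost Ω Z x z ≤ freeZoneCost Ω Z x y + freeZoneCost Ω Z y z := by
  have hsymm : geodesicDist Ω z y = geodesicDist Ω y z := curveCost_comm
  rcases min_choice (geodesicDist Ω x y) (geodesicInfDist Ω Z x + geodesicInfDist Ω Z y)
    with h | h <;>
  rcases min_choice (geodesicDist Ω y z) (geodesicInfDist Ω Z y + geodesicInfDist Ω Z z)
    with h' | h' <;>
  rw [freeZoneCost, freeZoneCost, freeZoneCost, h, h']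
  · exact (min_le_left _ _).trans curveCost_triangle
  · refine (min_le_right _ _).trans ?_
    rw [← add_assoc]
    gcongr
    exact geodesicInfDist_le_add
  · refine (min_le_right _ _).trans ?_
    rw [add_assoc, ← hsymm, add_comm _ (geodesicDist Ω z y)]
    gcongr
    exact geodesicInfDist_le_add
  · refine (min_le_right _ _).trans ?_
    rw [add_assoc]
    gcongr
    exact le_add_self.trans le_add_self

theorem freeZoneCost_eq_zero (hZ : Z ⊆ closure Ω) (hx : x ∈ Z) (hy : y ∈ Z) :
    freeZoneCost Ω Z x y = 0 := by
  have h : ∀ w ∈ Z, geodesicInfDist Ω Z w = 0 := fun w hw =>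
    le_antisymm ((iInf₂_le w hw).trans_eq (curveCost_self (hZ hw))) zero_le
  simp [freeZoneCost, h x hx, h y hy]

theorem curveCost_le_freeZoneCost (h0 : ∀ a ∈ Z, ∀ b ∈ Z, curveCost Ω Z a b = 0) :
    curveCost Ω Z x y ≤ freeZoneCost Ω Z x y := by
  refine le_min curveCost_le_geodesicDist ?_
  simp only [geodesicInfDist, ENNReal.iInf_add, ENNReal.add_iInf]
  refine le_iInf₂ fun b hb => le_iInf₂ fun a ha => ?_
  calc curveCost Ω Z x y
      ≤ curveCost Ω Z x a + (curveCost Ω Z a b + curveCost Ω Z b y) :=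
        curveCost_triangle.trans (by gcongr; exact curveCost_triangle)
    _ ≤ geodesicDist Ω x a + geodesicDist Ω y b := by
        rw [h0 a ha b hb, zero_add, curveCost_comm (x := b)]
        gcongr <;> exact curveCost_le_geodesicDist

theorem measure_add_le_of_inter_null {α : Type*} [MeasurableSpace α] {m : Measure α}
    {P Q S : Set α} (hQ : MeasurableSet Q) (hPS : P ⊆ S) (hQS : Q ⊆ S) (h : m (P ∩ Q) = 0) :
    m P + m Q ≤ m S := by
  rw [← measure_union_add_inter P hQ, h, add_zero]
  exact measure_mono (union_subset hPS hQS)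

theorem geodesicDist_le_of_lipschitzWith {f : ℝ → EuclideanSpace ℝ (Fin n)} {K : ℝ≥0}
    (hf : LipschitzWith K f) {a b : ℝ} (hab : a ≤ b) (hΩ : f '' Icc a b ⊆ closure Ω) :
    geodesicDist Ω (f a) (f b) ≤ Measure.hausdorffMeasure 1 (f '' Icc a b) := by
  have := curveCost_le_of_lipschitzWith (Z := ∅) hf hab hΩ
  rwa [sdiff_empty] at this

/-- Going along a curve up to its first meeting with `Z` and after its last one costs at least
`freeZoneCost`. -/
theorem freeZoneCost_le_curveCost (hZ : IsClosed Z) :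
    freeZoneCost Ω Z x y ≤ curveCost Ω Z x y := by
  refine le_iInf₂ fun γ hγ => ?_
  obtain ⟨f, K, hf, hl, hr, he⟩ := hγ.exists_extension
  have hΩ : ∀ {a b : ℝ}, 0 ≤ a → b ≤ 1 → f '' Icc a b ⊆ closure Ω := fun ha hb =>
    (image_mono (Icc_subset_Icc ha hb)).trans (he.subset.trans hγ.2.2.2)
  have hmeas : ∀ a b : ℝ, MeasurableSet (f '' Icc a b) := fun a b =>
    (isCompact_Icc.image hf.continuous).measurableSet
  have hsub : ∀ {a b : ℝ}, 0 ≤ a → b ≤ 1 → f '' Icc a b ⊆ range γ := fun ha hb =>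
    (image_mono (Icc_subset_Icc ha hb)).trans he.subset
  have hx : f 0 = x := hl 0 le_rfl
  have hy : f 1 = y := hr 1 le_rfl
  have hsing : ∀ p : EuclideanSpace ℝ (Fin n),
      (Measure.hausdorffMeasure 1 : Measure (EuclideanSpace ℝ (Fin n))) {p} = 0 := fun p => by
    have := hausdorffMeasure_segment p p
    simpa using this
  by_cases hne : (range γ ∩ Z).Nonempty
  swap
  · refine (min_le_left _ _).trans ?_
    have h := geodesicDist_le_of_lipschitzWith hf zero_le_one (hΩ le_rfl le_rfl)
    rw [hx, hy, he] at h
    rwa [(disjoint_iff_inter_eq_empty.2 (not_nonempty_iff_eq_empty.1 hne)).sdiff_eq_left]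
  have hcomp : IsCompact (Icc (0 : ℝ) 1 ∩ f ⁻¹' Z) :=
    isCompact_Icc.inter_right (hZ.preimage hf.continuous)
  have hne' : (Icc (0 : ℝ) 1 ∩ f ⁻¹' Z).Nonempty := by
    obtain ⟨p, hp, hpZ⟩ := hne
    rw [← he] at hp
    obtain ⟨t, ht, rfl⟩ := hp
    exact ⟨t, ht, hpZ⟩
  obtain ⟨t₁, ⟨ht₁, hZ₁⟩, hmin⟩ := hcomp.exists_isLeast hne'
  obtain ⟨t₂, ⟨ht₂, hZ₂⟩, hmax⟩ := hcomp.exists_isGreatest hne'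
  have hlt₁ : ∀ t, 0 ≤ t → t < t₁ → f t ∉ Z := fun t h0 h1 hZt =>
    absurd (hmin ⟨⟨h0, h1.le.trans ht₁.2⟩, hZt⟩) (not_le.2 h1)
  have hlt₂ : ∀ t, t₂ < t → t ≤ 1 → f t ∉ Z := fun t h0 h1 hZt =>
    absurd (hmax ⟨⟨ht₂.1.trans h0.le, h1⟩, hZt⟩) (not_le.2 h0)
  -- With `t₁`, `t₂` the first and last times in `Z`, the initial and final arcs may overlap outside
  -- `Z`, and then their lengths cannot be added. In that case a shortcut from one arc to the other
  -- avoids `Z` altogether.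
  by_cases hmeet : ((f '' Icc 0 t₁ \ Z) ∩ (f '' Icc t₂ 1)).Nonempty
  · refine (min_le_left _ _).trans ?_
    have hcomp' : IsCompact (Icc (0 : ℝ) t₁ ∩ f ⁻¹' (f '' Icc t₂ 1)) :=
      isCompact_Icc.inter_right ((isCompact_Icc.image hf.continuous).isClosed.preimage
        hf.continuous)
    obtain ⟨_, ⟨⟨t, ht, rfl⟩, htZ⟩, htA⟩ := hmeet
    have htlt : t < t₁ := lt_of_le_of_ne ht.2 fun h => htZ (h ▸ hZ₁)
    -- The earliest meeting time: with `f r = f s`, the arcs over `[0, s]` and `[r, 1]` share only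
    -- the point `f s`.
    obtain ⟨s, ⟨hs, hsA⟩, hsmin⟩ := hcomp'.exists_isLeast ⟨t, ht, htA⟩
    have hslt : s < t₁ := (hsmin ⟨ht, htA⟩).trans_lt htlt
    have hsZ : f s ∉ Z := hlt₁ s hs.1 hslt
    obtain ⟨r, hr', hrs⟩ := hsA
    have hrlt : t₂ < r := lt_of_le_of_ne hr'.1 fun h => hsZ (hrs ▸ h ▸ hZ₂)
    have hr0 : 0 ≤ r := ht₂.1.trans hrlt.le
    have hs1 : s ≤ 1 := hs.2.trans ht₁.2
    have hA := geodesicDist_le_of_lipschitzWith hf hs.1 (hΩ le_rfl hs1)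
    have hB := geodesicDist_le_of_lipschitzWith hf hr'.2 (hΩ hr0 le_rfl)
    rw [hx] at hA
    rw [hy, hrs] at hB
    refine (curveCost_triangle.trans (add_le_add hA hB)).trans ?_
    refine measure_add_le_of_inter_null (hmeas _ _) ?_ ?_ ?_
    · refine subset_sdiff.2 ⟨hsub le_rfl hs1, disjoint_left.2 ?_⟩
      rintro _ ⟨t, ht, rfl⟩
      exact hlt₁ t ht.1 (ht.2.trans_lt hslt)
    · refine subset_sdiff.2 ⟨hsub hr0 le_rfl, disjoint_left.2 ?_⟩
      rintro _ ⟨t, ht, rfl⟩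
      exact hlt₂ t (hrlt.trans_le ht.1) ht.2
    · refine measure_mono_null ?_ (hsing (f s))
      rintro _ ⟨⟨t, ht, rfl⟩, w, hw, hwt⟩
      have : s ≤ t := hsmin ⟨⟨ht.1, ht.2.trans hslt.le⟩, w, ⟨hrlt.le.trans hw.1, hw.2⟩, hwt⟩
      rw [le_antisymm ht.2 this]
      rfl
  · refine (min_le_right _ _).trans ?_
    have hA := geodesicDist_le_of_lipschitzWith hf ht₁.1 (hΩ le_rfl ht₁.2)
    have hB := geodesicDist_le_of_lipschitzWith hf ht₂.2 (hΩ ht₂.1 le_rfl)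
    rw [hx] at hA
    rw [hy, geodesicDist, curveCost_comm] at hB
    -- Each arc touches `Z` only at its endpoint, which is negligible for `ℋ¹`.
    have hrem : ∀ (S : Set (EuclideanSpace ℝ (Fin n))) (p : EuclideanSpace ℝ (Fin n)),
        S \ Z ∪ {p} ⊇ S →
        (Measure.hausdorffMeasure 1 : Measure (EuclideanSpace ℝ (Fin n))) S ≤
          Measure.hausdorffMeasure 1 (S \ Z) := by
      intro S p h
      exact (measure_mono h).trans ((measure_union_le _ _).trans_eq (by rw [hsing, add_zero]))
    have hA' := hA.trans (hrem _ (f t₁) (by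
      rintro _ ⟨t, ht, rfl⟩
      rcases ht.2.eq_or_lt with rfl | h
      · exact Or.inr rfl
      · exact Or.inl ⟨⟨t, ht, rfl⟩, hlt₁ t ht.1 h⟩))
    have hB' := hB.trans (hrem _ (f t₂) (by
      rintro _ ⟨t, ht, rfl⟩
      rcases ht.1.eq_or_lt with rfl | h
      · exact Or.inr rfl
      · exact Or.inl ⟨⟨t, ht, rfl⟩, hlt₂ t h ht.2⟩))
    refine (add_le_add ((iInf₂_le (f t₁) hZ₁).trans hA') ((iInf₂_le (f t₂) hZ₂).trans hB')).trans ?_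
    refine measure_add_le_of_inter_null ((hmeas _ _).diff hZ.measurableSet)
      (sdiff_subset_sdiff_left (hsub le_rfl ht₁.2)) (sdiff_subset_sdiff_left (hsub ht₂.1 le_rfl)) ?_
    rw [not_nonempty_iff_eq_empty] at hmeet
    exact measure_mono_null (fun p hp => hmeet.subset ⟨hp.1, hp.2.1⟩) measure_empty

theorem curveCost_eq_freeZoneCost (hZ : IsClosed Z)
    (h0 : ∀ a ∈ Z, ∀ b ∈ Z, curveCost Ω Z a b = 0) :
    curveCost Ω Z x y = freeZoneCost Ω Z x y :=
  le_antisymm (curveCost_le_freeZoneCost h0) (freeZoneCost_le_curveCost hZ)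

end Curves

/-! ### Geodesic distance on a Lipschitz domain -/

section Domain

variable {n : ℕ} {Ω Z : Set (EuclideanSpace ℝ (Fin n))}

theorem HasLipschitzBoundary.exists_chart (h : HasLipschitzBoundary Ω)
    {p : EuclideanSpace ℝ (Fin n)} (hp : p ∈ frontier Ω) :
    ∃ e : EuclideanSpace ℝ (Fin n), ‖e‖ = 1 ∧
      ∃ (K : ℝ≥0) (g : EuclideanSpace ℝ (Fin n) → ℝ), LipschitzWith K g ∧
        (∀ (x : EuclideanSpace ℝ (Fin n)) (t : ℝ), g (x + t • e) = g x) ∧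
        ∃ r > 0, (∀ x ∈ Metric.ball p r, g x < inner ℝ e x → x ∈ Ω) ∧
          ∀ x ∈ Metric.ball p r, x ∈ closure Ω → g x ≤ inner ℝ e x := by
  obtain ⟨e, he, K, g, hg, hge, U, hU, hUΩ⟩ := h p hp
  obtain ⟨r, hr, hrU⟩ := Metric.mem_nhds_iff.1 hU
  refine ⟨e, he, K, g, hg, hge, r, hr, fun x hx hgx => (hUΩ x (hrU hx)).2 hgx, fun x hx hxΩ => ?_⟩
  have hcl : IsClosed {y | g y ≤ inner ℝ e y} :=
    isClosed_le hg.continuous (by fun_prop)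
  have : x ∈ closure (Metric.ball p r ∩ Ω) := Metric.isOpen_ball.inter_closure ⟨hx, hxΩ⟩
  exact closure_minimal (fun y hy => ((hUΩ y (hrU hy.1)).1 hy.2).le) hcl this

/-- At each boundary point, some direction points into the domain. -/
theorem HasLipschitzBoundary.exists_inward (h : HasLipschitzBoundary Ω)
    {p : EuclideanSpace ℝ (Fin n)} (hp : p ∈ frontier Ω) :
    ∃ e : EuclideanSpace ℝ (Fin n), ‖e‖ = 1 ∧ ∃ r > 0, ∀ x ∈ closure Ω, ∀ t : ℝ, 0 < t →
      x ∈ Metric.ball p r → x + t • e ∈ Metric.ball p r → x + t • e ∈ Ω := by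
  obtain ⟨e, he, K, g, hg, hge, r, hr, hΩ, hcl⟩ := h.exists_chart hp
  refine ⟨e, he, r, hr, fun x hx t ht hxr hxt => hΩ _ hxt ?_⟩
  rw [hge, inner_add_right, inner_smul_right, real_inner_self_eq_norm_sq, he]
  linarith [hcl x hxr hx]

/-- Climb from both points along `e` by a height proportional to `dist x y`, then join the lifted
points by a segment, which lies above the graph. -/
theorem HasLipschitzBoundary.geodesicDist_le_near_frontier (h : HasLipschitzBoundary Ω)
    {p : EuclideanSpace ℝ (Fin n)} (hp : p ∈ frontier Ω) :
    ∃ r > 0, ∃ C : ℝ≥0, ∀ x ∈ closure Ω ∩ Metric.ball p r, ∀ y ∈ closure Ω ∩ Metric.ball p r,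
      geodesicDist Ω x y ≤ C * edist x y := by
  obtain ⟨e, he, K, g, hg, hge, r, hr, hΩ, hcl⟩ := h.exists_chart hp
  have hr' : 0 < r / (2 * K + 5) := by positivity
  have hmul : r / (2 * K + 5) * (2 * K + 5) = r := by field_simp
  -- The height `s` below is less than `2 (K + 2) ρ`, so lifted points stay within `ρ + 2 (K + 2) ρ
  -- = r` of `p`.
  set ρ := r / (2 * K + 5) with hρ
  have hρr : ρ ≤ r := by nlinarith [K.2]
  refine ⟨ρ, hr', 2 * (K + 2) + 1, ?_⟩
  rintro x ⟨hx, hxr⟩ y ⟨hy, hyr⟩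
  rcases eq_or_ne x y with rfl | hxy
  · simp [geodesicDist, curveCost_self hx]
  have hd : 0 < dist x y := dist_pos.2 hxy
  have hd' : dist x y < 2 * ρ := by
    have := dist_triangle_right x y p
    rw [Metric.mem_ball] at hxr hyr
    linarith
  -- Along the segment `g` rises by at most `K * dist x y` and the height falls by at most `dist x
  -- y`; `K + 2` exceeds `K + 1`, giving strict clearance.
  set s : ℝ := (K + 2) * dist x y with hs
  have hs0 : 0 < s := by positivity
  have hball : ∀ w ∈ Metric.ball p ρ, ∀ t ∈ Icc 0 s, w + t • e ∈ Metric.ball p r := by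
    intro w hw t ht
    rw [Metric.mem_ball] at hw ⊢
    have h1 : dist (w + t • e) w = t := by
      rw [dist_eq_norm, add_sub_cancel_left, norm_smul, he, mul_one, Real.norm_of_nonneg ht.1]
    have h2 : s < (K + 2) * (2 * ρ) := by
      rw [hs]
      gcongr
    have := dist_triangle (w + t • e) w p
    nlinarith [ht.2]
  have hinner : ∀ (w : EuclideanSpace ℝ (Fin n)) (t : ℝ),
      inner ℝ e (w + t • e) = inner ℝ e w + t := by
    intro w t
    rw [inner_add_right, inner_smul_right, real_inner_self_eq_norm_sq, he]
    ring
  have hvert : ∀ w ∈ closure Ω, w ∈ Metric.ball p ρ →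
      geodesicDist Ω w (w + s • e) ≤ ENNReal.ofReal s := by
    intro w hw hwr
    refine (curveCost_le_edist ?_).trans_eq ?_
    · rw [segment_eq_image']
      rintro _ ⟨θ, hθ, rfl⟩
      simp only [add_sub_cancel_left, smul_smul]
      rcases hθ.1.eq_or_lt with rfl | h0
      · simpa using hw
      · refine subset_closure (hΩ _ (hball w hwr _ ⟨by positivity, ?_⟩) ?_)
        · nlinarith [hθ.2]
        · rw [hge, hinner]
          have := hcl w (Metric.ball_subset_ball hρr hwr) hw
          have : 0 < θ * s := by positivity
          linarith
    · rw [edist_comm, edist_eq_enorm_sub, add_sub_cancel_left, enorm_smul,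
        ← ofReal_norm e, he, ENNReal.ofReal_one, mul_one, Real.enorm_of_nonneg hs0.le]
  have hhor : geodesicDist Ω (x + s • e) (y + s • e) ≤ edist x y := by
    refine (curveCost_le_edist ?_).trans_eq (edist_add_right _ _ _)
    rw [segment_eq_image']
    rintro _ ⟨θ, hθ, rfl⟩
    have hw : x + θ • (y - x) ∈ Metric.ball p ρ :=
      (convex_ball p ρ).segment_subset hxr hyr (by
        rw [segment_eq_image']
        exact ⟨θ, hθ, rfl⟩)
    have heq : x + s • e + θ • (y + s • e - (x + s • e)) = (x + θ • (y - x)) + s • e := by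
      rw [add_sub_add_right_eq_sub]
      abel
    simp only [heq]
    refine subset_closure (hΩ _ (hball _ hw _ ⟨hs0.le, le_rfl⟩) ?_)
    rw [hge, hinner]
    have hn : ‖θ • (y - x)‖ ≤ dist x y := by
      rw [norm_smul, Real.norm_of_nonneg hθ.1, ← dist_eq_norm, dist_comm y x]
      nlinarith [hθ.2]
    have h1 : g (x + θ • (y - x)) ≤ g x + K * dist x y := by
      have h2 := hg.dist_le_mul (x + θ • (y - x)) x
      rw [Real.dist_eq, dist_eq_norm (x + θ • (y - x)), add_sub_cancel_left] at h2
      have h3 : (K : ℝ) * ‖θ • (y - x)‖ ≤ K * dist x y := by gcongr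
      linarith [le_abs_self (g (x + θ • (y - x)) - g x)]
    have h2 : -dist x y ≤ inner ℝ e (θ • (y - x)) := by
      have := abs_real_inner_le_norm e (θ • (y - x))
      rw [he, one_mul] at this
      linarith [neg_abs_le (inner ℝ e (θ • (y - x)))]
    rw [inner_add_right]
    have := hcl x (Metric.ball_subset_ball hρr hxr) hx
    nlinarith
  have hsE : ENNReal.ofReal s = (K + 2 : ℝ≥0) * edist x y := by
    rw [hs, edist_dist, ENNReal.ofReal_mul (by positivity)]
    congr 1
    exact ENNReal.ofReal_coe_nnreal (p := K + 2)
  calc geodesicDist Ω x y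
      ≤ geodesicDist Ω x (x + s • e) + (geodesicDist Ω (x + s • e) (y + s • e)
          + geodesicDist Ω (y + s • e) y) :=
        curveCost_triangle.trans (add_le_add le_rfl curveCost_triangle)
    _ ≤ ENNReal.ofReal s + (edist x y + ENNReal.ofReal s) := by
        gcongr
        · exact hvert x hx hxr
        · exact curveCost_comm.trans_le (hvert y hy hyr)
    _ = (2 * (K + 2) + 1 : ℝ≥0) * edist x y := by
        rw [hsE]
        push_cast
        ring

theorem geodesicDist_le_nhds (hΩ : IsOpen Ω) (h : HasLipschitzBoundary Ω)
    {p : EuclideanSpace ℝ (Fin n)} (hp : p ∈ closure Ω) :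
    ∃ r > 0, ∃ C : ℝ≥0, ∀ x ∈ closure Ω ∩ Metric.ball p r, ∀ y ∈ closure Ω ∩ Metric.ball p r,
      geodesicDist Ω x y ≤ C * edist x y := by
  by_cases hpΩ : p ∈ Ω
  · obtain ⟨r, hr, hrΩ⟩ := Metric.isOpen_iff.1 hΩ p hpΩ
    refine ⟨r, hr, 1, fun x hx y hy => ?_⟩
    rw [ENNReal.coe_one, one_mul]
    exact curveCost_le_edist
      (((convex_ball p r).segment_subset hx.2 hy.2).trans (hrΩ.trans subset_closure))
  · exact h.geodesicDist_le_near_frontier ⟨hp, by rwa [hΩ.interior_eq]⟩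

/-- Being at finite distance is symmetric, transitive and locally true, hence holds throughout the
connected set `closure Ω`. -/
theorem geodesicDist_lt_top (hΩ : IsOpen Ω) (hconn : IsConnected Ω) (h : HasLipschitzBoundary Ω)
    {x y : EuclideanSpace ℝ (Fin n)} (hx : x ∈ closure Ω) (hy : y ∈ closure Ω) :
    geodesicDist Ω x y < ⊤ := by
  refine hconn.closure.isPreconnected.induction₂ (fun x y => geodesicDist Ω x y < ⊤) ?_ ?_ ?_ hx hy
  · intro x hx
    obtain ⟨r, hr, C, hC⟩ := geodesicDist_le_nhds hΩ h hx
    filter_upwards [self_mem_nhdsWithin, nhdsWithin_le_nhds (Metric.ball_mem_nhds x hr)]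
      with y hy hyr
    exact (hC x ⟨hx, Metric.mem_ball_self hr⟩ y ⟨hy, hyr⟩).trans_lt
      (ENNReal.mul_lt_top ENNReal.coe_lt_top (edist_lt_top _ _))
  · intro x y z _ _ _ hxy hyz
    exact curveCost_triangle.trans_lt (ENNReal.add_lt_top.2 ⟨hxy, hyz⟩)
  · intro x y _ _ hxy
    exact curveCost_comm.trans_lt hxy

theorem freeZoneCost_lt_top (hΩ : IsOpen Ω) (hconn : IsConnected Ω) (h : HasLipschitzBoundary Ω)
    {x y : EuclideanSpace ℝ (Fin n)} (hx : x ∈ closure Ω) (hy : y ∈ closure Ω) :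
    freeZoneCost Ω Z x y < ⊤ :=
  (min_le_left _ _).trans_lt (geodesicDist_lt_top hΩ hconn h hx hy)

theorem toReal_freeZoneCost_triangle (hΩ : IsOpen Ω) (hconn : IsConnected Ω)
    (h : HasLipschitzBoundary Ω) (x y z : closure Ω) :
    (freeZoneCost Ω Z x z).toReal ≤ (freeZoneCost Ω Z x y).toReal
      + (freeZoneCost Ω Z y z).toReal := by
  have h1 := (freeZoneCost_lt_top (Z := Z) hΩ hconn h x.2 y.2).ne
  have h2 := (freeZoneCost_lt_top (Z := Z) hΩ hconn h y.2 z.2).ne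
  rw [← ENNReal.toReal_add h1 h2]
  exact ENNReal.toReal_mono (ENNReal.add_ne_top.2 ⟨h1, h2⟩) freeZoneCost_triangle

theorem continuous_toReal_freeZoneCost (hΩ : IsOpen Ω) (hconn : IsConnected Ω)
    (h : HasLipschitzBoundary Ω) :
    Continuous fun p : closure Ω × closure Ω => (freeZoneCost Ω Z p.1 p.2).toReal := by
  set c : closure Ω → closure Ω → ℝ := fun x y => (freeZoneCost Ω Z x y).toReal with hc
  have hsymm : ∀ x y, c x y = c y x := fun x y => by simp only [hc, freeZoneCost_comm]
  have htri : ∀ x y z, c x z ≤ c x y + c y z := toReal_freeZoneCost_triangle hΩ hconn h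
  have hlim : ∀ x, Filter.Tendsto (fun y => c x y) (𝓝 x) (𝓝 0) := by
    intro x
    obtain ⟨r, hr, C, hC⟩ := geodesicDist_le_nhds hΩ h x.2
    have hdist : Filter.Tendsto (fun y => C * dist x y) (𝓝 x) (𝓝 0) := by
      have : Continuous fun y => C * dist x y := by fun_prop
      simpa using this.tendsto x
    refine squeeze_zero' (Filter.Eventually.of_forall fun y => ENNReal.toReal_nonneg) ?_ hdist
    filter_upwards [Metric.ball_mem_nhds x hr] with y hy
    refine ENNReal.toReal_le_of_le_ofReal (by positivity) ((min_le_left _ _).trans ?_)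
    refine (hC x ⟨x.2, Metric.mem_ball_self hr⟩ y ⟨y.2, hy⟩).trans_eq ?_
    rw [ENNReal.ofReal_mul C.coe_nonneg, ← edist_dist, ENNReal.ofReal_coe_nnreal,
      Subtype.edist_eq]
  rw [continuous_iff_continuousAt]
  rintro ⟨x, y⟩
  rw [ContinuousAt, tendsto_iff_dist_tendsto_zero]
  have hsum : Filter.Tendsto (fun p : closure Ω × closure Ω => c x p.1 + c y p.2) (𝓝 (x, y))
      (𝓝 0) := by
    have h1 := (hlim x).comp (continuous_fst.tendsto (x, y))
    have h2 := (hlim y).comp (continuous_snd.tendsto (x, y))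
    simpa using h1.add h2
  refine squeeze_zero (fun _ => dist_nonneg) (fun p => ?_) hsum
  rw [Real.dist_eq, abs_le]
  change -(c x p.1 + c y p.2) ≤ c p.1 p.2 - c x y ∧ c p.1 p.2 - c x y ≤ c x p.1 + c y p.2
  constructor
  · linarith [htri x p.1 y, htri p.1 p.2 y, hsymm y p.2]
  · linarith [htri p.1 x p.2, htri x y p.2, hsymm x p.1]

end Domain

/-! ### Gradient bounds give Lipschitz bounds for the cost -/

section Gradient

/-- The Hausdorff measure of the image of a set under a locally Lipschitz function. -/
theorem hausdorffMeasure_image_le_of_locally_lipschitz {X Y : Type*} [MetricSpace X]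
    [SecondCountableTopology X] [MeasurableSpace X] [BorelSpace X] [MetricSpace Y]
    [MeasurableSpace Y] [BorelSpace Y] {f : X → Y} {K : ℝ≥0} {S : Set X} (hS : MeasurableSet S)
    (hf : ∀ x ∈ S, ∃ U ∈ 𝓝 x, LipschitzOnWith K f U) :
    (Measure.hausdorffMeasure 1 : Measure Y) (f '' S) ≤ K * Measure.hausdorffMeasure 1 S := by
  rcases S.eq_empty_or_nonempty with rfl | ⟨x₀, hx₀⟩
  · simp
  choose! U hU hUf using hf
  obtain ⟨t, htS, htc, htU⟩ := TopologicalSpace.countable_cover_nhdsWithin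
    (f := fun x => interior (U x)) (s := S)
    fun x hx => nhdsWithin_le_nhds (interior_mem_nhds.2 (hU x hx))
  have htne : t.Nonempty := by
    obtain ⟨y, hy, -⟩ := mem_iUnion₂.1 (htU hx₀)
    exact ⟨y, hy⟩
  obtain ⟨a, rfl⟩ := htc.exists_eq_range htne
  have haS : ∀ i, a i ∈ S := fun i => htS ⟨i, rfl⟩
  let V : ℕ → Set X := fun i => interior (U (a i))
  have hcov : S = ⋃ i, S ∩ disjointed V i := by
    rw [← inter_iUnion, iUnion_disjointed]
    refine (inter_eq_left.2 fun x hx => ?_).symm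
    simpa [V] using htU hx
  -- Disjoint measurable pieces are needed so that their measures add up exactly and the constant
  -- `K` is not lost.
  have hmeas : ∀ i, MeasurableSet (S ∩ disjointed V i) := fun i =>
    hS.inter (MeasurableSet.disjointed (fun j => isOpen_interior.measurableSet) i)
  have hdisj : Pairwise (Function.onFun Disjoint fun i => S ∩ disjointed V i) := fun i j hij =>
    (disjoint_disjointed V hij).mono inter_subset_right inter_subset_right
  calc (Measure.hausdorffMeasure 1 : Measure Y) (f '' S)
      = Measure.hausdorffMeasure 1 (⋃ i, f '' (S ∩ disjointed V i)) := by
        rw [← image_iUnion, ← hcov]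
    _ ≤ ∑' i, Measure.hausdorffMeasure 1 (f '' (S ∩ disjointed V i)) := measure_iUnion_le _
    _ ≤ ∑' i, K * Measure.hausdorffMeasure 1 (S ∩ disjointed V i) := by
        refine ENNReal.tsum_le_tsum fun i => ?_
        have hsub : S ∩ disjointed V i ⊆ U (a i) :=
          inter_subset_right.trans ((disjointed_subset V i).trans interior_subset)
        simpa using ((hUf (a i) (haS i)).mono hsub).hausdorffMeasure_image_le zero_le_one
    _ = K * Measure.hausdorffMeasure 1 S := by
        rw [ENNReal.tsum_mul_left, ← measure_iUnion hdisj hmeas, ← hcov]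

variable {n : ℕ} {Ω Z : Set (EuclideanSpace ℝ (Fin n))} {x y : EuclideanSpace ℝ (Fin n)}
  {φ : EuclideanSpace ℝ (Fin n) → ℝ}

/-- The image of a curve under `φ` is connected, so it covers the interval between the end values,
whose length is its `ℋ¹` measure. The curve is never differentiated. -/
theorem ofReal_abs_sub_le_geodesicDist {K : ℝ≥0} (hK : 0 < K)
    (hf : ∀ x ∈ closure Ω, ∃ U ∈ 𝓝 x, LipschitzOnWith K φ U) :
    ENNReal.ofReal |φ x - φ y| ≤ K * geodesicDist Ω x y := by
  rw [mul_comm, ← ENNReal.div_le_iff (by simpa using hK.ne') ENNReal.coe_ne_top]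
  refine le_iInf₂ fun γ hγ => ?_
  rw [ENNReal.div_le_iff (by simpa using hK.ne') ENNReal.coe_ne_top, mul_comm, sdiff_empty]
  obtain ⟨L, hL⟩ := hγ.1
  have hcomp : IsCompact (range γ) := isCompact_range hL.continuous
  have hcont : ContinuousOn φ (range γ) := by
    intro z hz
    obtain ⟨U, hU, hUf⟩ := hf z (hγ.2.2.2 hz)
    exact ((hUf.continuousOn).continuousAt hU).continuousWithinAt
  have hconn : IsPreconnected (φ '' range γ) :=
    (isPreconnected_range hL.continuous).image φ hcont
  have hsub : uIcc (φ y) (φ x) ⊆ φ '' range γ :=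
    hconn.ordConnected.uIcc_subset ⟨y, ⟨1, hγ.2.2.1⟩, rfl⟩ ⟨x, ⟨0, hγ.2.1⟩, rfl⟩
  calc ENNReal.ofReal |φ x - φ y| = Measure.hausdorffMeasure 1 (uIcc (φ y) (φ x)) := by
        rw [hausdorffMeasure_real, Real.volume_interval]
    _ ≤ Measure.hausdorffMeasure 1 (φ '' range γ) := measure_mono hsub
    _ ≤ K * Measure.hausdorffMeasure 1 (range γ) :=
        hausdorffMeasure_image_le_of_locally_lipschitz hcomp.measurableSet
          fun z hz => hf z (hγ.2.2.2 hz)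

theorem ofReal_abs_sub_le_freeZoneCost {K : ℝ≥0} (hK : 0 < K)
    (hf : ∀ x ∈ closure Ω, ∃ U ∈ 𝓝 x, LipschitzOnWith K φ U) (hφ : ∀ z ∈ Z, φ z = 0) :
    ENNReal.ofReal |φ x - φ y| ≤ K * freeZoneCost Ω Z x y := by
  have hinf : ∀ w, ENNReal.ofReal |φ w| ≤ K * geodesicInfDist Ω Z w := by
    intro w
    rw [mul_comm, ← ENNReal.div_le_iff (by simpa using hK.ne') ENNReal.coe_ne_top]
    refine le_iInf₂ fun z hz => ?_
    rw [ENNReal.div_le_iff (by simpa using hK.ne') ENNReal.coe_ne_top, mul_comm]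
    simpa [hφ z hz] using ofReal_abs_sub_le_geodesicDist (x := w) (y := z) hK hf
  rcases min_choice (geodesicDist Ω x y) (geodesicInfDist Ω Z x + geodesicInfDist Ω Z y)
    with h | h <;> rw [freeZoneCost, h]
  · exact ofReal_abs_sub_le_geodesicDist hK hf
  · rw [mul_add]
    refine (ENNReal.ofReal_le_ofReal (abs_sub _ _)).trans ?_
    rw [ENNReal.ofReal_add (abs_nonneg _) (abs_nonneg _)]
    exact add_le_add (hinf x) (hinf y)

/-- A smooth function vanishing on `Z`, with gradient bounded by `s` on the closure of `Ω`, is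
`s`-Lipschitz for the cost. -/
theorem abs_sub_le_mul_freeZoneCost (hφ : ContDiff ℝ ∞ φ) {s : ℝ} (hs : 0 ≤ s)
    (hgrad : ∀ x ∈ closure Ω, ‖gradient φ x‖ ≤ s) (hφZ : ∀ z ∈ Z, φ z = 0)
    (hfin : freeZoneCost Ω Z x y < ⊤) :
    |φ x - φ y| ≤ s * (freeZoneCost Ω Z x y).toReal := by
  -- A gradient bound by `s` gives a local Lipschitz constant `K` only for `K > s`; the limit `K →
  -- s` follows.
  have hlt : ∀ K : ℝ≥0, s < K → |φ x - φ y| ≤ K * (freeZoneCost Ω Z x y).toReal := by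
    intro K hK
    have hK0 : 0 < K := by exact_mod_cast hs.trans_lt hK
    have hloc : ∀ x ∈ closure Ω, ∃ U ∈ 𝓝 x, LipschitzOnWith K φ U := by
      intro x hx
      have hC : ContDiffAt ℝ 1 φ x := (hφ.contDiffAt).of_le (by simp)
      refine hC.exists_lipschitzOnWith_of_nnnorm_lt K ?_
      rw [← NNReal.coe_lt_coe, coe_nnnorm]
      refine lt_of_le_of_lt ?_ hK
      have := hgrad x hx
      rwa [gradient, LinearIsometryEquiv.norm_map] at this
    have := ofReal_abs_sub_le_freeZoneCost (x := x) (y := y) hK0 hloc hφZ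
    rw [← ENNReal.toReal_ofReal (abs_nonneg (φ x - φ y)), ← ENNReal.coe_toReal K,
      ← ENNReal.toReal_mul]
    exact ENNReal.toReal_mono (ENNReal.mul_lt_top ENNReal.coe_lt_top hfin).ne this
  have hcont : Filter.Tendsto (fun K : ℝ => K * (freeZoneCost Ω Z x y).toReal) (𝓝[>] s)
      (𝓝 (s * (freeZoneCost Ω Z x y).toReal)) :=
    ((continuous_id.mul continuous_const).tendsto s).mono_left nhdsWithin_le_nhds
  refine ge_of_tendsto hcont ?_
  filter_upwards [self_mem_nhdsWithin] with K hK
  exact hlt ⟨K, hs.trans (le_of_lt hK)⟩ hK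

end Gradient

/-! ### Vector measures with a density -/

section VectorMeasure

variable {X V W G : Type*} [MeasurableSpace X]
  [NormedAddCommGroup V] [NormedSpace ℝ V]
  [NormedAddCommGroup W] [NormedSpace ℝ W] [CompleteSpace W]
  [NormedAddCommGroup G] [NormedSpace ℝ G] [CompleteSpace G]

theorem variation_withDensityᵥ_lt_top {m : Measure X} {w : X → W} (hw : Integrable w m) :
    (m.withDensityᵥ w).variation univ < ⊤ := by
  rw [Measure.variation_withDensityᵥ hw, withDensity_apply _ MeasurableSet.univ,
    Measure.restrict_univ]
  exact hw.2

/-- Integration of a bounded function against a vector measure with a density. -/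
theorem integral_withDensityᵥ {m : Measure X} {w : X → W} (hw : Integrable w m)
    (B : V →L[ℝ] W →L[ℝ] G) {v : X → V} (hv : StronglyMeasurable v) {C : ℝ}
    (hC : ∀ x, ‖v x‖ ≤ C) :
    (m.withDensityᵥ w).integral v B = ∫ x, B (v x) (w x) ∂m := by
  set Λ := m.withDensityᵥ w with hΛ
  have hfin : IsFiniteMeasure Λ.variation := ⟨variation_withDensityᵥ_lt_top hw⟩
  have hsint : ∀ s : SimpleFunc X V, Λ.Integrable s := fun s => s.integrable_of_isFiniteMeasure
  have hbound : ∀ (s : X → V) (K : ℝ), (∀ x, ‖s x‖ ≤ K) → ∀ x,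
      ‖B (s x) (w x)‖ ≤ ‖B‖ * K * ‖w x‖ := by
    intro s K hs x
    refine (B.le_opNorm₂ _ _).trans ?_
    gcongr
    exact hs x
  have hmeas : ∀ s : X → V, StronglyMeasurable s →
      AEStronglyMeasurable (fun x => B (s x) (w x)) m := fun s hs =>
    B.aestronglyMeasurable_comp₂ hs.aestronglyMeasurable hw.aestronglyMeasurable
  have hsint' : ∀ s : SimpleFunc X V, Integrable (fun x => B (s x) (w x)) m := by
    intro s
    obtain ⟨K, hK⟩ := s.exists_forall_norm_le
    exact (hw.norm.const_mul (‖B‖ * K)).mono' (hmeas s s.stronglyMeasurable)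
      (Filter.Eventually.of_forall (hbound s K hK))
  have hsimple : ∀ s : SimpleFunc X V, Λ.integral s B = ∫ x, B (s x) (w x) ∂m := by
    intro s
    induction s using SimpleFunc.induction with
    | const c hs =>
      rename_i s
      have h1 : Λ.integral (s.indicator fun _ => c) B = B c (Λ s) :=
        setToFun_indicator_const _ hs (measure_ne_top _ _) c
      rw [hΛ, withDensityᵥ_apply hw hs, ← ContinuousLinearMap.integral_comp_comm _ hw.restrict,
        ← integral_indicator hs] at h1
      simp only [SimpleFunc.coe_piecewise, SimpleFunc.coe_const, Function.const_zero,
        piecewise_eq_indicator]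
      refine h1.trans (integral_congr_ae (Filter.Eventually.of_forall fun x => ?_))
      by_cases hx : x ∈ s <;> simp [hx, Function.const]
    | add hd hf hg =>
      rename_i f g
      rw [SimpleFunc.coe_add, VectorMeasure.integral_add (hsint f) (hsint g), hf, hg,
        ← integral_add (hsint' f) (hsint' g)]
      simp
  have hlim : ∀ x, Filter.Tendsto (fun k => hv.approxBounded C k x) Filter.atTop (𝓝 (v x)) :=
    fun x => hv.tendsto_approxBounded_of_norm_le (hC x)
  rcases isEmpty_or_nonempty X with hX | ⟨⟨x₀⟩⟩
  · rw [VectorMeasure.integral_of_isEmpty, integral_of_isEmpty]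
  have hC0 : 0 ≤ C := (norm_nonneg _).trans (hC x₀)
  have hnorm : ∀ k x, ‖hv.approxBounded C k x‖ ≤ C := fun k x => hv.norm_approxBounded_le hC0 k x
  have h1 : Filter.Tendsto (fun k => Λ.integral (hv.approxBounded C k) B) Filter.atTop
      (𝓝 (Λ.integral v B)) :=
    VectorMeasure.tendsto_integral_filter_of_norm_le_const
      (Filter.Eventually.of_forall fun k => (SimpleFunc.stronglyMeasurable _).aestronglyMeasurable)
      ⟨C, Filter.Eventually.of_forall fun k => Filter.Eventually.of_forall (hnorm k)⟩
      (Filter.Eventually.of_forall hlim)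
  have h2 : Filter.Tendsto (fun k => ∫ x, B (hv.approxBounded C k x) (w x) ∂m) Filter.atTop
      (𝓝 (∫ x, B (v x) (w x) ∂m)) := by
    refine tendsto_integral_of_dominated_convergence (fun x => ‖B‖ * C * ‖w x‖)
      (fun k => hmeas _ (SimpleFunc.stronglyMeasurable _)) (hw.norm.const_mul _)
      (fun k => Filter.Eventually.of_forall (hbound _ C (hnorm k)))
      (Filter.Eventually.of_forall fun x => ?_)
    exact ((B.flip (w x)).continuous.tendsto _).comp (hlim x)
  simp only [hsimple] at h1
  exact tendsto_nhds_unique h1 h2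

end VectorMeasure

/-! ### Flows and their duality -/

section Flow

variable {n : ℕ} {Ω Z : Set (EuclideanSpace ℝ (Fin n))}

theorem continuous_gradient {φ : EuclideanSpace ℝ (Fin n) → ℝ} (hφ : ContDiff ℝ ∞ φ) :
    Continuous (gradient φ) :=
  (InnerProductSpace.toDual ℝ _).symm.continuous.comp (hφ.continuous_fderiv (by simp))

theorem gradient_add {φ ψ : EuclideanSpace ℝ (Fin n) → ℝ} (hφ : ContDiff ℝ ∞ φ)
    (hψ : ContDiff ℝ ∞ ψ) (x : EuclideanSpace ℝ (Fin n)) :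
    gradient (φ + ψ) x = gradient φ x + gradient ψ x := by
  rw [gradient, fderiv_add (hφ.differentiable (by simp) x) (hψ.differentiable (by simp) x), map_add]
  rfl

theorem gradient_const_smul {φ : EuclideanSpace ℝ (Fin n) → ℝ} (hφ : ContDiff ℝ ∞ φ) (r : ℝ)
    (x : EuclideanSpace ℝ (Fin n)) : gradient (r • φ) x = r • gradient φ x := by
  rw [gradient, fderiv_const_smul (hφ.differentiable (by simp) x), map_smul]
  rfl

/-- The smooth functions with compact support in the complement of `Z`. -/
def testFunctions (Z : Set (EuclideanSpace ℝ (Fin n))) :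
    Submodule ℝ (EuclideanSpace ℝ (Fin n) → ℝ) where
  carrier := {φ | ContDiff ℝ ∞ φ ∧ HasCompactSupport φ ∧ tsupport φ ⊆ Zᶜ}
  zero_mem' := ⟨contDiff_const, HasCompactSupport.zero, by simp [tsupport]⟩
  add_mem' := fun ⟨h1, h2, h3⟩ ⟨k1, k2, k3⟩ =>
    ⟨h1.add k1, h2.add k2, (tsupport_add _ _).trans (union_subset h3 k3)⟩
  smul_mem' := fun r _ ⟨h1, h2, h3⟩ =>
    ⟨contDiff_const.smul h1, h2.smul_left, (closure_mono
      (Function.support_const_smul_subset r _)).trans h3⟩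

theorem eq_zero_of_mem_testFunctions {φ : EuclideanSpace ℝ (Fin n) → ℝ}
    (hφ : φ ∈ testFunctions Z) : ∀ z ∈ Z, φ z = 0 := fun _ hz =>
  image_eq_zero_of_notMem_tsupport fun h => hφ.2.2 h hz

/-- A bound of `∫ φ d(μ - ν)` by the sup norm of the gradient yields a flow. -/
theorem exists_flow_of_dual_le [CompactSpace (closure Ω)] (μ ν : Measure (closure Ω))
    [IsProbabilityMeasure μ] [IsProbabilityMeasure ν] (T : ℝ)
    (hT : ∀ φ ∈ testFunctions Z, ∀ s : ℝ, 0 ≤ s → (∀ x ∈ closure Ω, ‖gradient φ x‖ ≤ s) →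
      (∫ x : closure Ω, φ x ∂ν) - ∫ x : closure Ω, φ x ∂μ ≤ s * T) :
    ∃ Λ : VectorMeasure (closure Ω) (EuclideanSpace ℝ (Fin n)),
      Λ.variation univ ≤ ENNReal.ofReal T ∧ NegDivEq Z Λ μ ν := by
  let B := Metric.closedBall (0 : EuclideanSpace ℝ (Fin n)) 1
  have hBc : CompactSpace B := isCompact_iff_compactSpace.1 (isCompact_closedBall _ _)
  have hi : ∀ (m : Measure (closure Ω)) [IsProbabilityMeasure m], ∀ φ ∈ testFunctions Z,
      Integrable (fun x : closure Ω => φ x) m := fun m _ φ hφ =>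
    integrable_of_continuous m (hφ.1.continuous.comp continuous_subtype_val)
  let L : (EuclideanSpace ℝ (Fin n) → ℝ) → ℝ :=
    fun φ => (∫ x : closure Ω, φ x ∂μ) - ∫ x : closure Ω, φ x ∂ν
  -- The unknown is a measure on pairs `(x, e)` with `e` in the unit ball. The terms in `φ` impose
  -- the divergence equation, the constant `s` bounds the total mass by `T`.
  let C : PointedCone ℝ (C(closure Ω × B, ℝ) × ℝ) :=
    { carrier := {p | ∃ φ ∈ testFunctions Z, ∃ s : ℝ,
        (∀ x e, p.1 (x, e) = inner ℝ (gradient φ x) (e : EuclideanSpace ℝ (Fin n)) + s) ∧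
        p.2 = L φ + s * T}
      zero_mem' := ⟨0, Submodule.zero_mem _, 0, by simp [gradient], by simp [L]⟩
      add_mem' := by
        rintro a b ⟨φ, hφ, s, h, h'⟩ ⟨ψ, hψ, t, k, k'⟩
        refine ⟨φ + ψ, Submodule.add_mem _ hφ hψ, s + t, fun x e => ?_, ?_⟩
        · simp only [Prod.fst_add, ContinuousMap.add_apply, h, k, gradient_add hφ.1 hψ.1,
            inner_add_left]
          ring
        · simp only [Prod.snd_add, h', k', L, Pi.add_apply]
          rw [integral_add (hi μ φ hφ) (hi μ ψ hψ), integral_add (hi ν φ hφ) (hi ν ψ hψ)]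
          ring
      smul_mem' := by
        rintro r a ⟨φ, hφ, s, h, h'⟩
        refine ⟨(r : ℝ) • φ, Submodule.smul_mem _ _ hφ, r * s, fun x e => ?_, ?_⟩
        · change (r : ℝ) * a.1 (x, e) = _
          rw [h, gradient_const_smul hφ.1, inner_smul_left]
          simp only [conj_trivial]
          ring
        · change (r : ℝ) * a.2 = _
          simp only [h', L, Pi.smul_apply, smul_eq_mul, integral_const_mul]
          ring }
  have hne : Nonempty (closure Ω) := by
    by_contra hX
    have : IsEmpty (closure Ω) := not_nonempty_iff.1 hX
    exact IsProbabilityMeasure.ne_zero μ (Measure.eq_zero_of_isEmpty μ)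
  have hC : ∀ p ∈ C, 0 ≤ p.1 → 0 ≤ p.2 := by
    rintro p ⟨φ, hφ, s, h, h'⟩ hp
    have hp' : ∀ (x : closure Ω) (e : EuclideanSpace ℝ (Fin n)), ‖e‖ ≤ 1 →
        0 ≤ inner ℝ (gradient φ x) e + s := fun x e he =>
      (hp (x, ⟨e, by simpa [B] using he⟩)).trans_eq (h _ _)
    have hs : 0 ≤ s := by
      obtain ⟨x⟩ := hne
      simpa using hp' x 0 (by simp)
    -- Nonnegativity at the direction opposite to the gradient is exactly `‖gradient φ x‖ ≤ s`.
    have hg : ∀ x ∈ closure Ω, ‖gradient φ x‖ ≤ s := by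
      intro x hx
      rcases eq_or_ne (gradient φ x) 0 with h0 | h0
      · simpa [h0] using hs
      · have h1 : ‖gradient φ x‖ ≠ 0 := norm_ne_zero_iff.2 h0
        have := hp' ⟨x, hx⟩ (-(‖gradient φ x‖⁻¹ • gradient φ x)) (by
          rw [norm_neg, norm_smul, norm_inv, norm_norm, inv_mul_cancel₀ h1])
        simp only [inner_neg_right, inner_smul_right, real_inner_self_eq_norm_sq] at this
        have h2 : ‖gradient φ x‖⁻¹ * ‖gradient φ x‖ ^ 2 = ‖gradient φ x‖ := by field_simp
        linarith
    have := hT φ hφ s hs hg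
    rw [h']
    simp only [L]
    linarith
  obtain ⟨m, hm, hmC⟩ := exists_measure_integral_le C hC
    ⟨T, 0, Submodule.zero_mem _, 1, by simp [gradient], by simp [L]⟩
  have hmass : m univ ≤ ENNReal.ofReal T := by
    have := hmC (1, T) ⟨0, Submodule.zero_mem _, 1, by simp [gradient], by simp [L]⟩
    simp only [ContinuousMap.one_apply, integral_const, smul_eq_mul, mul_one] at this
    exact (ENNReal.le_ofReal_iff_toReal_le (measure_ne_top _ _)
      (ENNReal.toReal_nonneg.trans this)).2 this
  have hflow : ∀ φ ∈ testFunctions Z,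
      ∫ p : closure Ω × B, inner ℝ (gradient φ p.1) (p.2 : EuclideanSpace ℝ (Fin n)) ∂m = L φ := by
    have hle : ∀ φ ∈ testFunctions Z,
        ∫ p : closure Ω × B, inner ℝ (gradient φ p.1) (p.2 : EuclideanSpace ℝ (Fin n)) ∂m
          ≤ L φ := by
      intro φ hφ
      have hcont : Continuous fun p : closure Ω × B =>
          (inner ℝ (gradient φ p.1) (p.2 : EuclideanSpace ℝ (Fin n)) : ℝ) := by
        have := continuous_gradient hφ.1
        fun_prop
      exact hmC (⟨_, hcont⟩, L φ) ⟨φ, hφ, 0, by simp, by simp⟩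
    intro φ hφ
    refine le_antisymm (hle φ hφ) ?_
    have := hle ((-1 : ℝ) • φ) (Submodule.smul_mem _ _ hφ)
    simp only [gradient_const_smul hφ.1, inner_smul_left, conj_trivial, L, Pi.smul_apply,
      smul_eq_mul, integral_const_mul] at this
    simp only [L]
    linarith
  let w : closure Ω × B → EuclideanSpace ℝ (Fin n) := fun p => p.2
  have hwc : Continuous w := by fun_prop
  have hw1 : ∀ p, ‖w p‖ ≤ 1 := fun p => mem_closedBall_zero_iff.1 p.2.2
  have hw : Integrable w m :=
    (integrable_const (1 : ℝ)).mono' hwc.aestronglyMeasurable (Filter.Eventually.of_forall hw1)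
  have hfin : IsFiniteMeasure (m.withDensityᵥ w).variation := ⟨variation_withDensityᵥ_lt_top hw⟩
  -- The flow is the projection to `closure Ω` of `e` times `m`; as `‖e‖ ≤ 1`, its variation is at
  -- most the mass of `m`.
  refine ⟨(m.withDensityᵥ w).map Prod.fst, ?_, fun φ hφ hφc hφZ => ?_⟩
  · refine (VectorMeasure.variation_map_le univ).trans ?_
    rw [Measure.map_apply measurable_fst MeasurableSet.univ, preimage_univ,
      Measure.variation_withDensityᵥ hw, withDensity_apply _ MeasurableSet.univ,
      Measure.restrict_univ]
    refine le_trans ?_ hmass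
    calc ∫⁻ p, ‖w p‖ₑ ∂m ≤ ∫⁻ _, 1 ∂m := lintegral_mono fun p => by
          rw [← ofReal_norm]
          simpa using ENNReal.ofReal_le_ofReal (hw1 p)
      _ = m univ := by simp
  · have hgc : Continuous fun x : closure Ω => gradient φ (x : EuclideanSpace ℝ (Fin n)) :=
      (continuous_gradient hφ).comp continuous_subtype_val
    obtain ⟨K, hK⟩ := (isCompact_range hgc).isBounded.exists_norm_le
    have hK' : ∀ x : closure Ω, ‖gradient φ (x : EuclideanSpace ℝ (Fin n))‖ ≤ K :=
      fun x => hK _ ⟨x, rfl⟩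
    have hgs : StronglyMeasurable fun p : closure Ω × B =>
        gradient φ (p.1 : EuclideanSpace ℝ (Fin n)) :=
      (hgc.comp continuous_fst).stronglyMeasurable
    rw [VectorMeasure.integral_map measurable_fst hgc.aestronglyMeasurable
      ((integrable_const K).mono' hgs.aestronglyMeasurable
        (Filter.Eventually.of_forall fun p => hK' p.1)),
      integral_withDensityᵥ hw _ hgs fun p => hK' p.1]
    exact hflow φ ⟨hφ, hφc, hφZ⟩

/-- The easy half of the duality for flows. -/
theorem NegDivEq.sub_le {μ ν : Measure (closure Ω)}
    {Λ : VectorMeasure (closure Ω) (EuclideanSpace ℝ (Fin n))} (hΛ : Λ.variation univ < ⊤)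
    (h : NegDivEq Z Λ μ ν) {φ : EuclideanSpace ℝ (Fin n) → ℝ} (hφ : φ ∈ testFunctions Z) {s : ℝ}
    (hs : 0 ≤ s) (hgrad : ∀ x ∈ closure Ω, ‖gradient φ x‖ ≤ s) :
    (∫ x : closure Ω, φ x ∂μ) - ∫ x : closure Ω, φ x ∂ν ≤ s * (Λ.variation univ).toReal := by
  have hfin : IsFiniteMeasure Λ.variation := ⟨hΛ⟩
  rw [← h φ hφ.1 hφ.2.1 hφ.2.2]
  refine (Real.le_norm_self _).trans ((VectorMeasure.norm_integral_le_of_norm_le_const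
    (Filter.Eventually.of_forall fun x : closure Ω => hgrad x x.2)).trans ?_)
  refine mul_le_mul_of_nonneg_right ?_ ENNReal.toReal_nonneg
  exact mul_le_of_le_one_right hs (norm_innerSL_le ℝ)

end Flow

/-! ### Approximation of Lipschitz potentials by test functions -/

section Smoothing

variable {n : ℕ} {Ω Z : Set (EuclideanSpace ℝ (Fin n))}

/-- A Lipschitz domain admits a Lipschitz vector field along which its closure is pushed into the
domain. -/
theorem HasLipschitzBoundary.exists_inward_field (hlip : HasLipschitzBoundary Ω)
    (hcomp : IsCompact (closure Ω)) :
    ∃ (V : EuclideanSpace ℝ (Fin n) → EuclideanSpace ℝ (Fin n)) (L : ℝ≥0) (M : ℝ),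
      LipschitzWith L V ∧ (∀ x, ‖V x‖ ≤ M) ∧
      ∀ᶠ t in 𝓝[>] (0 : ℝ), ∀ x ∈ closure Ω, x + t • V x ∈ Ω := by
  have hfr : IsCompact (frontier Ω) := hcomp.of_isClosed_subset isClosed_frontier
    frontier_subset_closure
  have hin := fun (p : EuclideanSpace ℝ (Fin n)) (hp : p ∈ frontier Ω) => hlip.exists_inward hp
  choose! e he r hr hpush using hin
  obtain ⟨F, hF, hcov⟩ := hfr.elim_nhds_subcover (fun p => Metric.ball p (r p / 2))
    fun p hp => Metric.ball_mem_nhds p (half_pos (hr p hp))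
  let χ : EuclideanSpace ℝ (Fin n) → EuclideanSpace ℝ (Fin n) → ℝ :=
    fun p x => max (r p / 2 - dist x p) 0
  have hχ0 : ∀ p x, 0 ≤ χ p x := fun p x => le_max_right _ _
  have hχr : ∀ p ∈ F, ∀ x, χ p x ≤ r p / 2 := fun p hp x =>
    max_le (sub_le_self _ dist_nonneg) (half_pos (hr p (hF p hp))).le
  have hχlip : ∀ p x y, |χ p x - χ p y| ≤ dist x y := by
    intro p x y
    refine (abs_max_sub_max_le_abs _ _ _).trans ?_
    rw [sub_sub_sub_cancel_left, abs_sub_comm]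
    exact abs_dist_sub_le x y p
  set M : ℝ := ∑ p ∈ F, r p / 2 with hM
  have hsum : ∀ G ⊆ F, ∀ x, ‖∑ p ∈ G, χ p x • e p‖ ≤ M := by
    intro G hG x
    refine (norm_sum_le _ _).trans ?_
    refine le_trans ?_ (Finset.sum_le_sum_of_subset_of_nonneg hG fun p hp _ =>
      (half_pos (hr p (hF p hp))).le)
    refine Finset.sum_le_sum fun p hp => ?_
    rw [norm_smul, he p (hF p (hG hp)), mul_one, Real.norm_of_nonneg (hχ0 p x)]
    exact hχr p (hG hp) x
  refine ⟨fun x => ∑ p ∈ F, χ p x • e p, F.card, M, ?_, hsum F subset_rfl, ?_⟩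
  · refine LipschitzWith.of_dist_le_mul fun x y => ?_
    rw [dist_eq_norm, ← Finset.sum_sub_distrib]
    refine (norm_sum_le _ _).trans ?_
    have : ∀ p ∈ F, ‖χ p x • e p - χ p y • e p‖ ≤ dist x y := by
      intro p hp
      rw [← sub_smul, norm_smul, he p (hF p hp), mul_one]
      exact hχlip p x y
    simpa using Finset.sum_le_sum this
  have hsmall : ∀ᶠ t in 𝓝[>] (0 : ℝ), ∀ p ∈ F, t * M < r p / 2 := by
    rw [Filter.eventually_all_finset]
    intro p hp
    have : Filter.Tendsto (fun t : ℝ => t * M) (𝓝[>] 0) (𝓝 (0 * M)) :=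
      ((continuous_id.mul continuous_const).tendsto 0).mono_left nhdsWithin_le_nhds
    rw [zero_mul] at this
    exact this.eventually_lt_const (half_pos (hr p (hF p hp)))
  filter_upwards [hsmall, self_mem_nhdsWithin] with t ht ht0 x hx
  have ht0 : 0 < t := ht0
  -- The inward pushes are added one at a time. Each active one takes a point of `closure Ω` into
  -- `Ω`, and the smallness of `t` keeps all partial sums in the ball where that push is valid.
  have hind : ∀ G ⊆ F, x + t • ∑ p ∈ G, χ p x • e p ∈ closure Ω ∧
      ((x ∈ Ω ∨ ∃ p ∈ G, 0 < χ p x) → x + t • ∑ p ∈ G, χ p x • e p ∈ Ω) := by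
    classical
    intro G
    induction G using Finset.induction_on with
    | empty =>
      intro _
      simpa using hx
    | insert p G hpG ih =>
      intro hG
      have hGF : G ⊆ F := (Finset.subset_insert p G).trans hG
      have hpF : p ∈ F := hG (Finset.mem_insert_self p G)
      obtain ⟨ih1, ih2⟩ := ih hGF
      rcases (hχ0 p x).eq_or_lt with h0 | h0
      · have : ∑ q ∈ insert p G, χ q x • e q = ∑ q ∈ G, χ q x • e q := by
          rw [Finset.sum_insert hpG, ← h0, zero_smul, zero_add]
        rw [this]
        refine ⟨ih1, fun h => ih2 (h.imp_right ?_)⟩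
        rintro ⟨q, hq, hq0⟩
        rcases Finset.mem_insert.1 hq with rfl | hq
        · exact absurd h0 hq0.ne
        · exact ⟨q, hq, hq0⟩
      · have hxp : dist x p < r p / 2 := by
          by_contra hcon
          have : χ p x = 0 := max_eq_right (by linarith)
          linarith
        have hnear : ∀ H ⊆ F, x + t • ∑ q ∈ H, χ q x • e q ∈ Metric.ball p (r p) := by
          intro H hH
          rw [Metric.mem_ball]
          have h1 : dist (x + t • ∑ q ∈ H, χ q x • e q) x ≤ t * M := by
            rw [dist_eq_norm, add_sub_cancel_left, norm_smul, Real.norm_of_nonneg ht0.le]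
            exact mul_le_mul_of_nonneg_left (hsum H hH x) ht0.le
          linarith [dist_triangle (x + t • ∑ q ∈ H, χ q x • e q) x p, ht p hpF]
        have heq : x + t • ∑ q ∈ insert p G, χ q x • e q
            = (x + t • ∑ q ∈ G, χ q x • e q) + (t * χ p x) • e p := by
          rw [Finset.sum_insert hpG, smul_add, smul_smul]
          abel
        have hmem := hpush p (hF p hpF) _ ih1 (t * χ p x) (by positivity) (hnear G hGF)
          (by rw [← heq]; exact hnear _ hG)
        rw [← heq] at hmem
        exact ⟨subset_closure hmem, fun _ => hmem⟩
  refine (hind F subset_rfl).2 ?_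
  by_cases hxΩ : x ∈ Ω
  · exact Or.inl hxΩ
  · refine Or.inr ?_
    obtain ⟨p, hp, hxp⟩ := mem_iUnion₂.1 (hcov (show x ∈ frontier Ω from
      ⟨hx, fun h => hxΩ (interior_subset h)⟩))
    exact ⟨p, hp, lt_max_of_lt_left (sub_pos.2 hxp)⟩

/-- Mollification of a continuous function which is uniformly locally Lipschitz near `A`. -/
theorem exists_mollification {f : EuclideanSpace ℝ (Fin n) → ℝ} (hf : Continuous f)
    {A : Set (EuclideanSpace ℝ (Fin n))} {K : ℝ≥0} {r : ℝ} (hr : 0 < r)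
    (hlip : ∀ x ∈ A, LipschitzOnWith K f (Metric.ball x r)) {η : ℝ} (hη : 0 < η) :
    ∃ h : EuclideanSpace ℝ (Fin n) → ℝ, ContDiff ℝ ∞ h ∧ (∀ x ∈ A, |h x - f x| ≤ η) ∧
      (∀ x ∈ A, ‖gradient h x‖ ≤ K) ∧
      ∀ z, (∀ y ∈ Metric.ball z r, f y = 0) → ∀ y ∈ Metric.ball z (r / 2), h y = 0 := by
  -- Radius `r / 2` keeps translates of `ball x (r / 2)` inside `ball x r`; `η / (K + 1)` makes the
  -- error `K * ρ` at most `η`.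
  set ρ := min (r / 2) (η / (K + 1)) with hρ
  have hρ0 : 0 < ρ := lt_min (by positivity) (by positivity)
  have hρr : ρ ≤ r / 2 := min_le_left _ _
  have hρη : K * ρ ≤ η := by
    have h1 : ρ * (K + 1) ≤ η := (le_div_iff₀ (by positivity)).1 (min_le_right _ _)
    nlinarith
  let ψ : ContDiffBump (0 : EuclideanSpace ℝ (Fin n)) := ⟨ρ / 2, ρ, by positivity, by linarith⟩
  have hψout : ψ.rOut = ρ := rfl
  let h := convolution (ψ.normed volume) f (ContinuousLinearMap.lsmul ℝ ℝ) volume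
  have hdef : ∀ y, h y = ∫ t, ψ.normed volume t * f (y - t) := fun y => rfl
  have hzero : ∀ t, ρ ≤ ‖t‖ → ψ.normed volume t = 0 := by
    intro t ht
    have : t ∉ Function.support (ψ.normed volume) := by
      rw [ψ.support_normed_eq, mem_ball_zero_iff, hψout]
      exact not_lt.2 ht
    exact Function.notMem_support.1 this
  have hint : ∀ y, Integrable fun t => ψ.normed volume t * f (y - t) := by
    intro y
    refine Continuous.integrable_of_hasCompactSupport ?_
      (ψ.hasCompactSupport_normed (μ := volume)).mul_right
    have := ψ.continuous_normed (μ := volume)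
    fun_prop
  have hψint : Integrable (ψ.normed volume) :=
    ψ.continuous_normed.integrable_of_hasCompactSupport ψ.hasCompactSupport_normed
  have hsmooth : ContDiff ℝ ∞ h :=
    ψ.hasCompactSupport_normed.contDiff_convolution_left _ ψ.contDiff_normed hf.locallyIntegrable
  refine ⟨h, hsmooth, fun x hx => ?_, fun x hx => ?_, fun z hz y hy => ?_⟩
  · rw [← Real.dist_eq]
    refine ψ.dist_normed_convolution_le hf.aestronglyMeasurable fun y hy => ?_
    rw [hψout, Metric.mem_ball] at hy
    refine ((hlip x hx).dist_le_mul y ?_ x (Metric.mem_ball_self hr)).trans ?_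
    · rw [Metric.mem_ball]
      linarith
    · exact (mul_le_mul_of_nonneg_left hy.le K.2).trans hρη
  · rw [gradient, LinearIsometryEquiv.norm_map]
    refine norm_fderiv_le_of_lipschitzOn ℝ (Metric.ball_mem_nhds x (half_pos hr)) ?_
    refine LipschitzOnWith.of_dist_le_mul fun y hy y' hy' => ?_
    rw [Real.dist_eq, hdef, hdef, ← integral_sub (hint y) (hint y')]
    have hb : ∀ t, ‖ψ.normed volume t * f (y - t) - ψ.normed volume t * f (y' - t)‖
        ≤ ψ.normed volume t * (K * dist y y') := by
      intro t
      rw [← mul_sub, norm_mul, Real.norm_of_nonneg (ψ.nonneg_normed t)]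
      rcases lt_or_ge ‖t‖ ρ with ht | ht
      · refine mul_le_mul_of_nonneg_left ?_ (ψ.nonneg_normed t)
        have hmem : ∀ w ∈ Metric.ball x (r / 2), w - t ∈ Metric.ball x r := by
          intro w hw
          rw [Metric.mem_ball] at hw ⊢
          have h1 : dist (w - t) w = ‖t‖ := by simp
          linarith [dist_triangle (w - t) w x]
        have := (hlip x hx).dist_le_mul _ (hmem y hy) _ (hmem y' hy')
        rwa [dist_sub_right, Real.dist_eq] at this
      · simp [hzero t ht]
    refine (norm_integral_le_of_norm_le (hψint.mul_const _)
      (Filter.Eventually.of_forall hb)).trans_eq ?_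
    rw [integral_mul_const, ψ.integral_normed, one_mul]
  · rw [hdef]
    refine integral_eq_zero_of_ae (Filter.Eventually.of_forall fun t => ?_)
    rcases lt_or_ge ‖t‖ ρ with ht | ht
    · have : f (y - t) = 0 := by
        refine hz _ ?_
        rw [Metric.mem_ball] at hy ⊢
        have h1 : dist (y - t) y = ‖t‖ := by simp
        linarith [dist_triangle (y - t) y z]
      simp [this]
    · simp [hzero t ht]

/-- Soft thresholding at level `η`. -/
noncomputable def softThreshold (η a : ℝ) : ℝ := max (a - η) 0 + min (a + η) 0

theorem continuous_softThreshold (η : ℝ) : Continuous (softThreshold η) := by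
  unfold softThreshold
  fun_prop

theorem abs_softThreshold_sub_le {η : ℝ} (hη : 0 ≤ η) (a b : ℝ) :
    |softThreshold η a - softThreshold η b| ≤ |a - b| := by
  unfold softThreshold
  grind

theorem abs_softThreshold_sub_self_le {η : ℝ} (hη : 0 ≤ η) (a : ℝ) :
    |softThreshold η a - a| ≤ η := by
  unfold softThreshold
  grind

theorem softThreshold_eq_zero {η a : ℝ} (h : |a| ≤ η) : softThreshold η a = 0 := by
  unfold softThreshold
  grind

/-- Soft thresholding makes the potential vanish near `Z` without increasing its Lipschitz constant.
Composing with a small inward push `Φ` evaluates it only inside `Ω`, where small balls are convex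
and it is Euclidean 1-Lipschitz; mollification then costs only the factor due to `Φ`. -/
theorem exists_testFunction_approx (hΩ : IsOpen Ω) (hlip : HasLipschitzBoundary Ω)
    (hcomp : IsCompact (closure Ω)) (hZΩ : Z ⊆ closure Ω)
    {u : closure Ω → ℝ} (hu : Continuous u)
    (hu1 : ∀ x y : closure Ω, segment ℝ (x : EuclideanSpace ℝ (Fin n)) y ⊆ closure Ω →
      |u x - u y| ≤ dist x y)
    (huZ : ∀ x : closure Ω, (x : EuclideanSpace ℝ (Fin n)) ∈ Z → u x = 0) {ε : ℝ} (hε : 0 < ε) :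
    ∃ φ ∈ testFunctions Z, (∀ x ∈ closure Ω, ‖gradient φ x‖ ≤ 1 + ε) ∧
      ∀ x : closure Ω, |φ x - u x| ≤ ε := by
  have hcs : CompactSpace (closure Ω) := isCompact_iff_compactSpace.1 hcomp
  -- One third each for thresholding, displacement by `Φ` and mollification.
  set η := ε / 3 with hη
  have hη0 : 0 < η := by positivity
  obtain ⟨ρ, hρ0, hρ⟩ := Metric.uniformContinuous_iff.1
    (CompactSpace.uniformContinuous_of_continuous hu) η hη0
  obtain ⟨g, hg⟩ := ContinuousMap.exists_restrict_eq isClosed_closure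
    (⟨fun x => softThreshold η (u x), (continuous_softThreshold η).comp hu⟩ : C(closure Ω, ℝ))
  have hgu : ∀ x : closure Ω, g x = softThreshold η (u x) := fun x => DFunLike.congr_fun hg x
  obtain ⟨V, L, M, hVL, hVM, hVt⟩ := hlip.exists_inward_field hcomp
  have hlim : ∀ a : ℝ, ∀ b > 0, ∀ᶠ t in 𝓝[>] (0 : ℝ), t * a < b := by
    intro a b hb
    have : Filter.Tendsto (fun t : ℝ => t * a) (𝓝[>] 0) (𝓝 (0 * a)) :=
      ((continuous_id.mul continuous_const).tendsto 0).mono_left nhdsWithin_le_nhds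
    rw [zero_mul] at this
    exact this.eventually_lt_const hb
  have hpos : ∀ᶠ t in 𝓝[>] (0 : ℝ), 0 < t := self_mem_nhdsWithin
  -- `t * L < ε` gives the gradient bound `1 + ε`; `t * M < ρ / 2` keeps the displacement within the
  -- modulus of continuity of `u`.
  obtain ⟨t, ht, ht0, htL, htM⟩ := (hVt.and (hpos.and
    ((hlim L ε hε).and (hlim M (ρ / 2) (half_pos hρ0))))).exists
  let Φ : EuclideanSpace ℝ (Fin n) → EuclideanSpace ℝ (Fin n) := fun x => x + t • V x
  let τ : ℝ≥0 := ⟨t, ht0.le⟩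
  have hΦ : LipschitzWith (1 + τ * L) Φ := by
    refine LipschitzWith.id.add (LipschitzWith.of_dist_le_mul fun x y => ?_)
    rw [dist_smul₀, Real.norm_of_nonneg ht0.le, NNReal.coe_mul, mul_assoc]
    exact mul_le_mul_of_nonneg_left (hVL.dist_le_mul x y) ht0.le
  have hΦd : ∀ x, dist (Φ x) x < ρ / 2 := by
    intro x
    rw [dist_eq_norm, add_sub_cancel_left, norm_smul, Real.norm_of_nonneg ht0.le]
    exact (mul_le_mul_of_nonneg_left (hVM x) ht0.le).trans_lt htM
  have hΦΩ : Φ '' closure Ω ⊆ Ω := by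
    rintro _ ⟨x, hx, rfl⟩
    exact ht x hx
  obtain ⟨κ₀, hκ₀, hκΩ⟩ := (hcomp.image hΦ.continuous).exists_thickening_subset_open hΩ hΦΩ
  set κ := min κ₀ (ρ / 2) with hκ
  have hκ0 : 0 < κ := lt_min hκ₀ (half_pos hρ0)
  set r := κ / (1 + τ * L : ℝ≥0) with hr
  have hr0 : 0 < r := div_pos hκ0 (by positivity)
  have hballΩ : ∀ x ∈ closure Ω, Metric.ball (Φ x) κ ⊆ Ω := fun x hx =>
    (Metric.ball_subset_ball (min_le_left _ _)).trans
      ((Metric.ball_subset_thickening (mem_image_of_mem Φ hx) κ₀).trans hκΩ)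
  have hΦball : ∀ x, ∀ y ∈ Metric.ball x r, Φ y ∈ Metric.ball (Φ x) κ := by
    intro x y hy
    rw [Metric.mem_ball] at hy ⊢
    refine (hΦ.dist_le_mul y x).trans_lt ?_
    rw [mul_comm]
    exact (lt_div_iff₀ (by positivity)).1 hy
  have hglip : ∀ x ∈ closure Ω, LipschitzOnWith 1 g (Metric.ball (Φ x) κ) := by
    intro x hx
    refine LipschitzOnWith.of_dist_le_mul fun y hy y' hy' => ?_
    have hyΩ : y ∈ closure Ω := subset_closure (hballΩ x hx hy)
    have hyΩ' : y' ∈ closure Ω := subset_closure (hballΩ x hx hy')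
    have h1 := hu1 ⟨y, hyΩ⟩ ⟨y', hyΩ'⟩
      (((convex_ball _ _).segment_subset hy hy').trans ((hballΩ x hx).trans subset_closure))
    rw [NNReal.coe_one, one_mul, Real.dist_eq]
    have h2 := hgu ⟨y, hyΩ⟩
    have h3 := hgu ⟨y', hyΩ'⟩
    simp only at h2 h3
    rw [h2, h3]
    exact (abs_softThreshold_sub_le hη0.le _ _).trans h1
  have hflip : ∀ x ∈ closure Ω, LipschitzOnWith (1 * (1 + τ * L)) (g ∘ Φ) (Metric.ball x r) :=
    fun x hx => (hglip x hx).comp hΦ.lipschitzOnWith (hΦball x)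
  obtain ⟨h, hsm, happ, hgrad, hzero⟩ := exists_mollification (g.continuous.comp hΦ.continuous) hr0
    hflip hη0
  -- Near `z ∈ Z` the pushed points stay within `ρ` of `z`, so `|u| ≤ η` there and thresholding
  -- gives zero.
  have hfZ : ∀ z ∈ Z, ∀ y ∈ Metric.ball z (r / 2), h y = 0 := by
    intro z hz
    refine hzero z fun y hy => ?_
    have hyB := hΦball z y hy
    have hyΩ : Φ y ∈ closure Ω := subset_closure (hballΩ z (hZΩ hz) hyB)
    have h1 : dist (Φ y) z < ρ := by
      have h2 : dist (Φ y) (Φ z) < ρ / 2 := (Metric.mem_ball.1 hyB).trans_le (min_le_right _ _)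
      linarith [dist_triangle (Φ y) (Φ z) z, hΦd z]
    have h2 := hρ (a := ⟨Φ y, hyΩ⟩) (b := ⟨z, hZΩ hz⟩) h1
    rw [huZ ⟨z, hZΩ hz⟩ hz, Real.dist_eq, sub_zero] at h2
    exact (hgu ⟨Φ y, hyΩ⟩).trans (softThreshold_eq_zero h2.le)
  obtain ⟨R, hR0, hR⟩ := hcomp.isBounded.subset_ball_lt 0 0
  -- The cutoff gives compact support; it equals 1 near `closure Ω`, so values and gradients there
  -- are unchanged.
  let χ : ContDiffBump (0 : EuclideanSpace ℝ (Fin n)) := ⟨R, R + 1, hR0, by linarith⟩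
  have hχ1 : ∀ x ∈ closure Ω, (χ * h : EuclideanSpace ℝ (Fin n) → ℝ) =ᶠ[𝓝 x] h := by
    intro x hx
    filter_upwards [Metric.isOpen_ball.mem_nhds (hR hx)] with y hy
    rw [Pi.mul_apply, χ.one_of_mem_closedBall (Metric.ball_subset_closedBall hy), one_mul]
  refine ⟨χ * h, ⟨χ.contDiff.mul hsm, χ.hasCompactSupport.mul_right, ?_⟩, fun x hx => ?_,
    fun x => ?_⟩
  · intro z hz hzZ
    refine notMem_tsupport_iff_eventuallyEq.2 ?_ hz
    filter_upwards [Metric.ball_mem_nhds z (half_pos hr0)] with y hy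
    rw [Pi.mul_apply, hfZ z hzZ y hy, mul_zero]
    rfl
  · rw [gradient, (hχ1 x hx).fderiv_eq]
    refine (hgrad x hx).trans ?_
    have : ((1 * (1 + τ * L) : ℝ≥0) : ℝ) = 1 + t * L := by
      rw [one_mul]
      rfl
    rw [this]
    linarith
  · rw [(hχ1 x x.2).eq_of_nhds]
    have h1 := happ x x.2
    have hΦx : Φ x ∈ closure Ω := subset_closure (ht x x.2)
    have h2 : |(g ∘ Φ) x - g x| ≤ η := by
      have h3 : |u ⟨Φ x, hΦx⟩ - u x| < η :=
        hρ (a := ⟨Φ x, hΦx⟩) (b := x) ((hΦd x).trans (half_lt_self hρ0))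
      rw [Function.comp_apply, hgu x, show g (Φ x) = _ from hgu ⟨Φ x, hΦx⟩]
      exact (abs_softThreshold_sub_le hη0.le _ _).trans h3.le
    have h3 : |g x - u x| ≤ η := by
      rw [hgu x]
      exact abs_softThreshold_sub_self_le hη0.le _
    rw [abs_le] at h1 h2 h3 ⊢
    constructor <;> linarith [h1.1, h1.2, h2.1, h2.2, h3.1, h3.2]

end Smoothing

/-! ### Equality of the transport cost and the minimal flow mass -/

section Main

variable {n : ℕ} {Ω Z : Set (EuclideanSpace ℝ (Fin n))}

theorem lintegral_freeZoneCost [CompactSpace (closure Ω)] (hΩ : IsOpen Ω) (hconn : IsConnected Ω)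
    (hlip : HasLipschitzBoundary Ω) (γ : Measure (closure Ω × closure Ω)) [IsFiniteMeasure γ] :
    ∫⁻ p, freeZoneCost Ω Z p.1 p.2 ∂γ
      = ENNReal.ofReal (∫ p, (freeZoneCost Ω Z p.1 p.2).toReal ∂γ) := by
  rw [ofReal_integral_eq_lintegral_ofReal (integrable_of_continuous γ
    (continuous_toReal_freeZoneCost hΩ hconn hlip))
    (Filter.Eventually.of_forall fun _ => ENNReal.toReal_nonneg)]
  exact lintegral_congr fun p =>
    (ENNReal.ofReal_toReal (freeZoneCost_lt_top hΩ hconn hlip p.1.2 p.2.2).ne).symm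

theorem transportCost_freeZoneCost_lt_top [CompactSpace (closure Ω)] (hΩ : IsOpen Ω)
    (hconn : IsConnected Ω) (hlip : HasLipschitzBoundary Ω) (μ ν : Measure (closure Ω))
    [IsProbabilityMeasure μ] [IsProbabilityMeasure ν] :
    transportCost (fun x y : closure Ω => freeZoneCost Ω Z x y) μ ν < ⊤ := by
  refine (iInf₂_le (μ.prod ν) ⟨by simp, by simp⟩).trans_lt ?_
  rw [lintegral_freeZoneCost hΩ hconn hlip]
  exact ENNReal.ofReal_lt_top

/-- The easy half of the duality for transport plans. -/
theorem sub_le_mul_transportCost [CompactSpace (closure Ω)] (hΩ : IsOpen Ω)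
    (hconn : IsConnected Ω) (hlip : HasLipschitzBoundary Ω) (μ ν : Measure (closure Ω))
    [IsProbabilityMeasure μ] [IsProbabilityMeasure ν] {φ : EuclideanSpace ℝ (Fin n) → ℝ}
    (hφ : φ ∈ testFunctions Z) {s : ℝ} (hs : 0 ≤ s)
    (hgrad : ∀ x ∈ closure Ω, ‖gradient φ x‖ ≤ s) :
    (∫ x : closure Ω, φ x ∂ν) - ∫ x : closure Ω, φ x ∂μ
      ≤ s * (transportCost (fun x y : closure Ω => freeZoneCost Ω Z x y) μ ν).toReal := by
  set D := (∫ x : closure Ω, φ x ∂ν) - ∫ x : closure Ω, φ x ∂μ with hD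
  have hφc : Continuous fun x : closure Ω => φ x := hφ.1.continuous.comp continuous_subtype_val
  have hplan : ∀ γ : Measure (closure Ω × closure Ω), γ.map Prod.fst = μ ∧ γ.map Prod.snd = ν →
      ENNReal.ofReal D ≤ ENNReal.ofReal s * ∫⁻ p, freeZoneCost Ω Z p.1 p.2 ∂γ := by
    rintro γ ⟨h1, h2⟩
    have hfin : IsFiniteMeasure γ := by
      refine ⟨?_⟩
      rw [← preimage_univ (f := Prod.fst), ← Measure.map_apply measurable_fst MeasurableSet.univ,
        h1]
      exact measure_lt_top _ _
    rw [lintegral_freeZoneCost hΩ hconn hlip, ← ENNReal.ofReal_mul hs, ← integral_const_mul]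
    refine ENNReal.ofReal_le_ofReal ?_
    have hD' : D = ∫ p : closure Ω × closure Ω, (φ p.2 - φ p.1) ∂γ := by
      have hi₁ : Integrable (fun p : closure Ω × closure Ω => φ p.1) γ :=
        integrable_of_continuous γ (hφc.comp continuous_fst)
      have hi₂ : Integrable (fun p : closure Ω × closure Ω => φ p.2) γ :=
        integrable_of_continuous γ (hφc.comp continuous_snd)
      rw [integral_sub hi₂ hi₁, hD, ← h1, ← h2,
        integral_map measurable_fst.aemeasurable hφc.aestronglyMeasurable,
        integral_map measurable_snd.aemeasurable hφc.aestronglyMeasurable]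
    rw [hD']
    refine integral_mono (integrable_of_continuous γ
      ((hφc.comp continuous_snd).sub (hφc.comp continuous_fst)))
      (integrable_of_continuous γ
        (continuous_const.mul (continuous_toReal_freeZoneCost hΩ hconn hlip))) fun p => ?_
    have := abs_sub_le_mul_freeZoneCost (x := p.1) (y := p.2) hφ.1 hs hgrad
      (eq_zero_of_mem_testFunctions hφ) (freeZoneCost_lt_top hΩ hconn hlip p.1.2 p.2.2)
    rw [abs_sub_comm] at this
    exact (le_abs_self _).trans this
  -- The infimum over plans is reached by dividing by `s`; for `s = 0` the product plan suffices.
  rcases hs.eq_or_lt with rfl | hs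
  · have := hplan (μ.prod ν) ⟨by simp, by simp⟩
    rw [ENNReal.ofReal_zero, zero_mul, nonpos_iff_eq_zero, ENNReal.ofReal_eq_zero] at this
    simpa using this
  · have h0 : ENNReal.ofReal s ≠ 0 := by simpa using hs
    have : ENNReal.ofReal D / ENNReal.ofReal s
        ≤ transportCost (fun x y : closure Ω => freeZoneCost Ω Z x y) μ ν := by
      refine le_iInf₂ fun γ hγ => ?_
      rw [ENNReal.div_le_iff h0 ENNReal.ofReal_ne_top, mul_comm]
      exact hplan γ hγ
    rw [← ENNReal.ofReal_div_of_pos hs, ENNReal.ofReal_le_iff_le_toReal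
      (transportCost_freeZoneCost_lt_top hΩ hconn hlip μ ν).ne, div_le_iff₀' hs] at this
    exact this

/-- Every flow costs at least as much as the transport. -/
theorem NegDivEq.transportCost_le (hΩ : IsOpen Ω) (hconn : IsConnected Ω)
    (hlip : HasLipschitzBoundary Ω) (hcomp : IsCompact (closure Ω)) (hZΩ : Z ⊆ closure Ω)
    {μ ν : Measure (closure Ω)} [IsProbabilityMeasure μ] [IsProbabilityMeasure ν]
    {Λ : VectorMeasure (closure Ω) (EuclideanSpace ℝ (Fin n))} (hΛ : Λ.variation univ < ⊤)
    (h : NegDivEq Z Λ μ ν) :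
    transportCost (fun x y : closure Ω => freeZoneCost Ω Z x y) μ ν ≤ Λ.variation univ := by
  have hcs : CompactSpace (closure Ω) := isCompact_iff_compactSpace.1 hcomp
  have hsymm : ∀ x y : closure Ω, (freeZoneCost Ω Z x y).toReal = (freeZoneCost Ω Z y x).toReal :=
    fun x y => by rw [freeZoneCost_comm]
  obtain ⟨γ, hγ, h1, h2, hle⟩ := exists_plan_of_lipschitz_dual_le μ ν
    (fun x y : closure Ω => (freeZoneCost Ω Z x y).toReal)
    (continuous_toReal_freeZoneCost hΩ hconn hlip) (fun x => by simp [freeZoneCost_self x.2])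
    (toReal_freeZoneCost_triangle hΩ hconn hlip) (Λ.variation univ).toReal (by
      intro u hu
      -- The cost vanishes on `Z × Z`, so `u` is constant on `Z`. Subtracting that constant does not
      -- change `∫ u dμ - ∫ u dν`, the two masses being equal.
      obtain ⟨a, ha⟩ : ∃ a, ∀ x : closure Ω, (x : EuclideanSpace ℝ (Fin n)) ∈ Z → u x = a := by
        rcases Z.eq_empty_or_nonempty with rfl | ⟨z, hz⟩
        · exact ⟨0, fun x hx => absurd hx (notMem_empty _)⟩
        · refine ⟨u ⟨z, hZΩ hz⟩, fun x hx => ?_⟩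
          have k1 := hu x ⟨z, hZΩ hz⟩
          have k2 := hu ⟨z, hZΩ hz⟩ x
          rw [freeZoneCost_eq_zero hZΩ hx hz, ENNReal.toReal_zero] at k1
          rw [freeZoneCost_eq_zero hZΩ hz hx, ENNReal.toReal_zero] at k2
          linarith
      have hseg : ∀ x y : closure Ω, segment ℝ (x : EuclideanSpace ℝ (Fin n)) y ⊆ closure Ω →
          |(u x - a) - (u y - a)| ≤ dist x y := by
        intro x y hxy
        have k : (freeZoneCost Ω Z x y).toReal ≤ dist x y := by
          refine ENNReal.toReal_le_of_le_ofReal dist_nonneg ((min_le_left _ _).trans ?_)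
          rw [← edist_dist]
          exact curveCost_le_edist hxy
        rw [sub_sub_sub_cancel_right, abs_le]
        constructor
        · linarith [hu y x, hsymm x y]
        · linarith [hu x y]
      have hε : ∀ ε : ℝ, 0 < ε → ∫ x, u x ∂μ - ∫ x, u x ∂ν
          ≤ (1 + ε) * (Λ.variation univ).toReal + 2 * ε := by
        intro ε hε
        obtain ⟨φ, hφ, hgrad, happ⟩ := exists_testFunction_approx hΩ hlip hcomp hZΩ
          (u := fun x => u x - a) (by fun_prop) hseg (fun x hx => by simp [ha x hx]) hε
        have hle := h.sub_le hΛ hφ (by positivity) hgrad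
        have hφc : Continuous fun x : closure Ω => φ x :=
          hφ.1.continuous.comp continuous_subtype_val
        have k1 : ∫ x, u x ∂μ ≤ ∫ x : closure Ω, φ x ∂μ + (a + ε) := by
          have : ∫ x, u x ∂μ ≤ ∫ x : closure Ω, (φ x + (a + ε)) ∂μ := by
            refine integral_mono (integrable_of_continuous μ u.continuous)
              (integrable_of_continuous μ (hφc.add continuous_const)) fun x => ?_
            simp only
            linarith [(abs_le.1 (happ x)).1]
          rw [integral_add (integrable_of_continuous μ hφc) (integrable_const _)] at this
          simpa using this
        have k2 : ∫ x : closure Ω, φ x ∂ν + (a - ε) ≤ ∫ x, u x ∂ν := by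
          have : ∫ x : closure Ω, (φ x + (a - ε)) ∂ν ≤ ∫ x, u x ∂ν := by
            refine integral_mono (integrable_of_continuous ν (hφc.add continuous_const))
              (integrable_of_continuous ν u.continuous) fun x => ?_
            simp only
            linarith [(abs_le.1 (happ x)).2]
          rw [integral_add (integrable_of_continuous ν hφc) (integrable_const _)] at this
          simpa using this
        linarith
      have hlim : Filter.Tendsto (fun ε : ℝ => (1 + ε) * (Λ.variation univ).toReal + 2 * ε)
          (𝓝[>] 0) (𝓝 (Λ.variation univ).toReal) := by
        have : Continuous fun ε : ℝ => (1 + ε) * (Λ.variation univ).toReal + 2 * ε := by fun_prop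
        have := this.tendsto 0
        simp only [add_zero, one_mul, mul_zero] at this
        exact this.mono_left nhdsWithin_le_nhds
      refine ge_of_tendsto hlim ?_
      filter_upwards [self_mem_nhdsWithin] with ε h0 using hε ε h0)
  refine (iInf₂_le γ ⟨h1, h2⟩).trans ?_
  rw [lintegral_freeZoneCost hΩ hconn hlip, ← ENNReal.ofReal_toReal hΛ.ne]
  exact ENNReal.ofReal_le_ofReal hle

/-- Farkas yields a flow of mass at most the transport cost; the lower bound valid for every flow
forces equality for this one and gives minimality. -/
theorem isLeast_flowMasses_freeZoneCost (hΩ : IsOpen Ω) (hbdd : Bornology.IsBounded Ω)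
    (hconn : IsConnected Ω) (hlip : HasLipschitzBoundary Ω) (hZΩ : Z ⊆ closure Ω)
    (μ ν : Measure (closure Ω)) [IsProbabilityMeasure μ] [IsProbabilityMeasure ν] :
    IsLeast (flowMasses Z μ ν)
      (transportCost (fun x y : closure Ω => freeZoneCost Ω Z x y) μ ν) := by
  have hcomp : IsCompact (closure Ω) := hbdd.isCompact_closure
  have hcs : CompactSpace (closure Ω) := isCompact_iff_compactSpace.1 hcomp
  have hfin := transportCost_freeZoneCost_lt_top (Z := Z) hΩ hconn hlip μ ν
  constructor
  · obtain ⟨Λ, hΛ, hdiv⟩ := exists_flow_of_dual_le μ ν _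
      fun φ hφ s hs hgrad => sub_le_mul_transportCost hΩ hconn hlip μ ν hφ hs hgrad
    rw [ENNReal.ofReal_toReal hfin.ne] at hΛ
    have hΛfin := hΛ.trans_lt hfin
    exact ⟨Λ, hΛfin, hdiv,
      le_antisymm hΛ (hdiv.transportCost_le hΩ hconn hlip hcomp hZΩ hΛfin)⟩
  · rintro _ ⟨Λ, hΛ, hdiv, rfl⟩
    exact hdiv.transportCost_le hΩ hconn hlip hcomp hZΩ hΛ

end Main

end GeodesicTransport

theorem mainTheorem9 {n : ℕ} (Ω Z : Set (EuclideanSpace ℝ (Fin n)))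
    (hΩ_open : IsOpen Ω) (hΩ_bdd : Bornology.IsBounded Ω) (hΩ_conn : IsConnected Ω)
    (hΩ_lip : GeodesicTransport.HasLipschitzBoundary Ω)
    (hZ : IsCompact Z) (hZΩ : Z ⊆ closure Ω)
    (μ ν : Measure (closure Ω)) [IsProbabilityMeasure μ] [IsProbabilityMeasure ν] :
    IsLeast (GeodesicTransport.flowMasses Z μ ν)
      (GeodesicTransport.transportCost
        (fun x y : closure Ω => GeodesicTransport.freeZoneCost Ω Z x y) μ ν) ∧
    ((∀ a ∈ Z, ∀ b ∈ Z, GeodesicTransport.curveCost Ω Z a b = 0) →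
      IsLeast (GeodesicTransport.flowMasses Z μ ν)
        (GeodesicTransport.transportCost
          (fun x y : closure Ω => GeodesicTransport.curveCost Ω Z x y) μ ν)) := by
  have h := GeodesicTransport.isLeast_flowMasses_freeZoneCost hΩ_open hΩ_bdd hΩ_conn hΩ_lip hZΩ μ ν
  refine ⟨h, fun h0 => ?_⟩
  simp only [GeodesicTransport.curveCost_eq_freeZoneCost hZ.isClosed h0]
  exact h
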